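/- Let $N$ be a Poisson random measure on a Polish space $\mathscr V$ with $\sigma$-finite intensity $\nu$, and let $\mathbb P(dN\mid\nu)$ denote its law, a measure on the space $\mathbb M$ of measures on $\mathscr V$. For measurable $g:\mathscr V\to[0,\infty)$ put $N(g)=\int g\,dN$ and $\Lambda(g)=\int_{\mathscr V}(1-e^{-g(v)})\,\nu(dv)$. Let $f_1,\dots,f_n:\mathscr V\to[0,\infty)$ be measurable and such that $\tau_i=N(f_i)$ satisfies $0<\tau_i<\infty$ almost surely. Let $\mu,\beta,\Delta$ be real constants, let $\epsilon_1,\dots,\epsilon_n$ be independent standard normal variables, independent of $N$, and let $\mathbf X=(X_1,\dots,X_n)$ with $$X_i=\mu\Delta+\tau_i\beta+\tau_i^{1/2}\epsilon_i,\qquad i=1,\dots,n .$$ Let $\phi(\cdot\mid m,s)$ be the normal density with mean $m$ and variance $s$, and for $x\in\mathbb R^n$ let $$\mathscr L(x)=\mathbb E\Big[\prod_{i=1}^n\phi(x_i\mid\mu\Delta+\beta\tau_i,\tau_i)\Big],\qquad \Pi_x(dN)=\mathscr L(x)^{-1}\prod_{i=1}^n\phi(x_i\mid\mu\Delta+\beta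 N(f_i),N(f_i))\,\mathbb P(dN\mid\nu)$$ be the likelihood and the posterior law of $N$ given $\mathbf X=x$. Put $A_i=x_i-\mu\Delta$, $\bar A=n^{-1}\sum_{i=1}^n A_i$, and, for $y\in\mathbb R_+^n=[0,\infty)^n$, $$\Omega_n(v)=\sum_{i=1}^n\Big(\frac{y_i^2}{2}+\frac{\beta^2}{2}\Big)f_i(v),\qquad \nu_{\Omega_n}(dv)=e^{-\Omega_n(v)}\nu(dv),$$ $$\mathscr Q_x(dy)=\frac{\pi^{-n}e^{-[\Lambda(\Omega_n)-n\bar A\beta]}\prod_{i=1}^n\cos(y_i|A_i|)}{\mathscr L(x)}\,dy .$$ **Proposition 2.2.** The map $x\mapsto\Pi_x$ is a version of the regular conditional distribution of $N$ given $\mathbf X$, and $\Pi_x$ is a probability measure for every $x$ with $x_i\ne\mu\Delta$ for all $i$ (hence for almost every $x$). For every measurable $f:\mathscr V\to[0,\infty)$ with $\Lambda(f+\Omega_n)<\infty$ for all $y\in\mathbb R^n_+$, its Laplace functional is $$\int_{\mathbb M}e^{-N(f)}\,\Pi_x(dN)=\int_{\mathbb R_+^n}\Big[\int_{\mathbb M}e^{-N(f)}\,\mathbb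 P(dN\mid\nu_{\Omega_n})\Big]\mathscr Q_x(dy)=\int_{\mathbb R_+^n}e^{-[\Lambda(f+\Omega_n)-\Lambda(\Omega_n)]}\,\mathscr Q_x(dy),$$ where, for every $y\in\mathbb R^n_+$, the inner integral equals $e^{-[\Lambda(f+\Omega_n)-\Lambda(\Omega_n)]}$. The integrals against $\mathscr Q_x$ are understood as follows. 1. For every $x$ with $x_i\ne\mu\Delta$ for all $i$, the formula holds with the integrals over $\mathbb R_+^n$ read as improper integrals, that is, as limits of the integrals over the boxes $\prod_{i=1}^n[0,M_i]$ as $M_1,\dots,M_n\to\infty$. 2. If $\int_{\mathbb R_+^n}e^{-\Lambda(\Omega_n)}\,dy<\infty$, then for every $x\in\mathbb R^n$ the law $\Pi_x$ is a probability measure, $\mathscr Q_x$ is a finite signed measure, and the formula holds with Lebesgue integrals. -/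

import Mathlib

open MeasureTheory ProbabilityTheory Filter Topology
open scoped ENNReal NNReal

noncomputable section

/-! ### Poisson random measures

Random measures on `V` are random elements of `Measure V`, which carries the σ-algebra generated by
the evaluations `m ↦ m s`, `s` measurable. -/

/-- The measure with unit masses at the points of a finite configuration. -/
def pointMeasure {V : Type*} [MeasurableSpace V] {k : ℕ} (p : Fin k → V) : Measure V :=
  ∑ i, Measure.dirac (p i)

theorem measurable_pointMeasure {V : Type*} [MeasurableSpace V] (k : ℕ) :
    Measurable (pointMeasure : (Fin k → V) → Measure V) := by
  unfold pointMeasure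
  exact Finset.measurable_fun_sum _ fun i _ => Measure.measurable_dirac.comp (measurable_pi_apply i)

/-- The law of a Poisson random measure with *finite* intensity `m`: with weight
`exp (-m(V)) / k!` on the `k`-point configurations, the points are distributed according to
`m ⊗ ⋯ ⊗ m` (that is: a Poisson number, of mean `m(V)`, of independent points with
common law `m / m(V)`). -/
def poissonLawFinite {V : Type*} [MeasurableSpace V] (m : Measure V) : Measure (Measure V) :=
  Measure.sum fun k : ℕ =>
    ENNReal.ofReal (Real.exp (-m.real Set.univ) / (k.factorial : ℝ)) •
      (Measure.pi fun _ : Fin k => m).map pointMeasure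

instance instIsProbabilityMeasurePoissonLawFinite {V : Type*} [MeasurableSpace V] (m : Measure V)
    [IsFiniteMeasure m] : IsProbabilityMeasure (poissonLawFinite m) := by
  constructor
  have key : ∀ k : ℕ,
      (ENNReal.ofReal (Real.exp (-m.real Set.univ) / (k.factorial : ℝ)) •
        (Measure.pi fun _ : Fin k => m).map pointMeasure) Set.univ
      = ENNReal.ofReal (Real.exp (-m.real Set.univ) *
          (m.real Set.univ ^ k / (k.factorial : ℝ))) := by
    intro k
    rw [Measure.smul_apply, Measure.map_apply (measurable_pointMeasure k) MeasurableSet.univ,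
      Set.preimage_univ, Measure.pi_univ, Finset.prod_const, Finset.card_univ, Fintype.card_fin,
      smul_eq_mul, ← ofReal_measureReal (μ := m) (s := Set.univ), ← ENNReal.ofReal_pow (by positivity),
      ← ENNReal.ofReal_mul (by positivity)]
    congr 1
    ring
  have hs : HasSum (fun k : ℕ => Real.exp (-m.real Set.univ) *
      (m.real Set.univ ^ k / (k.factorial : ℝ))) 1 := by
    have h := (NormedSpace.expSeries_div_hasSum_exp (m.real Set.univ)).mul_left
      (Real.exp (-m.real Set.univ))
    rwa [← Real.exp_eq_exp_ℝ, ← Real.exp_add, neg_add_cancel, Real.exp_zero] at h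
  rw [poissonLawFinite, Measure.sum_apply _ MeasurableSet.univ]
  simp_rw [key]
  rw [← ENNReal.ofReal_tsum_of_nonneg (fun k => by positivity) hs.summable, hs.tsum_eq,
    ENNReal.ofReal_one]

theorem measurable_measureSum {V : Type*} [MeasurableSpace V] :
    Measurable (Measure.sum : (ℕ → Measure V) → Measure V) := by
  refine Measure.measurable_of_measurable_coe _ fun s hs => ?_
  simp_rw [Measure.sum_apply _ hs]
  exact Measurable.tsum fun k => (Measure.measurable_coe hs).comp (measurable_pi_apply k)

/-- The law `ℙ(dN | ν)` of a Poisson random measure with intensity `ν` (s-finite; in particular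
σ-finite or boundedly finite): the law of `N₀ + N₁ + ⋯`, where the `Nₖ` are independent Poisson
random measures with finite intensities `νₖ` and `ν = ν₀ + ν₁ + ⋯`. -/
def poissonLaw {V : Type*} [MeasurableSpace V] (ν : Measure V) [SFinite ν] :
    Measure (Measure V) :=
  (Measure.infinitePi fun k : ℕ => poissonLawFinite (sfiniteSeq ν k)).map Measure.sum

instance instIsProbabilityMeasurePoissonLaw {V : Type*} [MeasurableSpace V] (ν : Measure V)
    [SFinite ν] : IsProbabilityMeasure (poissonLaw ν) :=
  Measure.isProbabilityMeasure_map measurable_measureSum.aemeasurable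

/-- `Λ(f) = ∫ (1 - e^{-f}) dν`, with values in `[0, ∞]`. -/
def laplaceExponent {V : Type*} [MeasurableSpace V] (ν : Measure V) (f : V → ℝ≥0) : ℝ≥0∞ :=
  ∫⁻ v, ENNReal.ofReal (1 - Real.exp (-(f v : ℝ))) ∂ν

/-- The Laplace functional `∫ e^{-N(f)} Q(dN)` at `f` of a law `Q` of random measures, where
`N(f) = ∫ f dN ∈ [0, ∞]` and `e^{-∞} = 0`. -/
def laplaceFunctional {V : Type*} [MeasurableSpace V] (Q : Measure (Measure V)) (f : V → ℝ≥0) : ℝ :=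
  (∫⁻ N, EReal.exp (-((∫⁻ v, (f v : ℝ≥0∞) ∂N : ℝ≥0∞) : EReal)) ∂Q).toReal

/-! ### The stochastic volatility model -/

/-- The linear functional `N(f) = ∫ f dN`; it is used for `τᵢ = N(fᵢ)`, which is almost surely
finite in the model. -/
def linearFunctional {V : Type*} [MeasurableSpace V] (f : V → ℝ≥0) (N : Measure V) : ℝ≥0 :=
  (∫⁻ v, (f v : ℝ≥0∞) ∂N).toNNReal

/-- The conditional density `∏ᵢ φ(xᵢ | μΔ + βτᵢ, τᵢ)` at `x` of the returns given `N`, where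
`τᵢ = N(fᵢ)` and `φ(· | m, v)` is the normal density with mean `m` and variance `v`. -/
def returnDensity {V : Type*} [MeasurableSpace V] {n : ℕ} (f : Fin n → V → ℝ≥0) (μ β Δ : ℝ)
    (x : Fin n → ℝ) (N : Measure V) : ℝ≥0∞ :=
  ∏ i, gaussianPDF (μ * Δ + β * linearFunctional (f i) N) (linearFunctional (f i) N) (x i)

/-- The likelihood `ℒ(x | μ, β) = 𝔼 [∏ᵢ φ(xᵢ | μΔ + βτᵢ, τᵢ)]`. -/
def likelihood {V : Type*} [MeasurableSpace V] (ν : Measure V) [SFinite ν] {n : ℕ}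
    (f : Fin n → V → ℝ≥0) (μ β Δ : ℝ) (x : Fin n → ℝ) : ℝ≥0∞ :=
  ∫⁻ N, returnDensity f μ β Δ x N ∂(poissonLaw ν)

/-- The posterior law of `N` given the returns `x`:
`∏ᵢ φ(xᵢ | μΔ + βτᵢ, τᵢ) ℙ(dN | ν) / ℒ(x | μ, β)`. -/
def posteriorLaw {V : Type*} [MeasurableSpace V] (ν : Measure V) [SFinite ν] {n : ℕ}
    (f : Fin n → V → ℝ≥0) (μ β Δ : ℝ) (x : Fin n → ℝ) : Measure (Measure V) :=
  (likelihood ν f μ β Δ x)⁻¹ • (poissonLaw ν).withDensity (returnDensity f μ β Δ x)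

/-- `Ωₙ(v) = ∑ᵢ (yᵢ²/2 + β²/2) fᵢ(v)`. -/
def bigOmega {V : Type*} {n : ℕ} (f : Fin n → V → ℝ≥0) (β : ℝ) (y : Fin n → ℝ) : V → ℝ≥0 :=
  fun v => ∑ i, Real.toNNReal (y i ^ 2 / 2 + β ^ 2 / 2) * f i v

/-- The tilted intensity `ν_Ω(dv) = e^{-Ω(v)} ν(dv)`. -/
abbrev tiltedIntensity {V : Type*} [MeasurableSpace V] (ν : Measure V) (Ω : V → ℝ≥0) : Measure V :=
  ν.withDensity fun v => ENNReal.ofReal (Real.exp (-(Ω v : ℝ)))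

/-- The density on the orthant `yᵢ ≥ 0` of the signed measure `𝒬_x(dy)`, namely
`π⁻ⁿ exp (-[Λ(Ωₙ) - n Ā β]) ∏ᵢ cos (yᵢ |Aᵢ|) / ℒ(x | μ, β)`, where `Aᵢ = xᵢ - μΔ` and `Ā` is the
mean of the `Aᵢ`. -/
def mixingDensity {V : Type*} [MeasurableSpace V] (ν : Measure V) [SFinite ν] {n : ℕ}
    (f : Fin n → V → ℝ≥0) (μ β Δ : ℝ) (x y : Fin n → ℝ) : ℝ :=
  (Real.pi ^ n)⁻¹ *
    Real.exp (-((laplaceExponent ν (bigOmega f β y)).toReal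
      - n * ((n : ℝ)⁻¹ * ∑ i, (x i - μ * Δ)) * β)) *
    (∏ i, Real.cos (y i * |x i - μ * Δ|)) / (likelihood ν f μ β Δ x).toReal

end

/-! The normal density depends on its variance `s` in a complicated way, but it is a cosine
transform: with `A = x - m`, φ(x | m + βs, s) = π⁻¹ e^{Aβ} ∫₀^∞ cos(y|A|) e^{-s(y²/2 + β²/2)} dy,
where `s` enters only through an exponential (`gaussianPDFReal_eq_integral_cosFactor`). For `s =
N(fᵢ)`, the product over `i` of these exponentials is `e^{-N(Ωₙ)}`. So, once the `N`- and
`y`-integrals are exchanged, the mean of `e^{-N(g)}` times the likelihood of `N` is an integral over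
`y` of cosines times `𝔼 e^{-N(g + Ωₙ)} = e^{-Λ(g + Ωₙ)}` (`lintegral_expNeg_poissonLaw`). Dividing
by the likelihood and splitting off `e^{-Λ(Ωₙ)}` gives the formula.

The exchange is the analytic point. On a bounded box Fubini applies, since everything is bounded.
The box integrals for fixed `N` are at most `∏ 2/|Aᵢ|`, uniformly in `N` and in the box
(`abs_setIntegral_cosFactor_le`), so dominated convergence in `N` yields the improper integral
whenever all `Aᵢ ≠ 0`. If `e^{-Λ(Ωₙ)}` is integrable, Fubini applies on the whole orthant, for every
`x`.

The conditional law is Bayes' formula: given `N` the returns have density `returnDensity`, so the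
pair has a density with respect to Lebesgue measure times the Poisson law, and the likelihood is the
density of the returns. -/

/-! ### The exponential on `[0, ∞]` and finite product measures -/

/-- `e^{-t}` for `t ∈ [0, ∞]`. -/
noncomputable def expNeg (t : ℝ≥0∞) : ℝ≥0∞ := EReal.exp (-(t : EReal))

theorem expNeg_zero : expNeg 0 = 1 := by simp [expNeg]

theorem expNeg_add (s t : ℝ≥0∞) : expNeg (s + t) = expNeg s * expNeg t := by
  rw [expNeg, EReal.coe_ennreal_add, EReal.neg_add, sub_eq_add_neg, EReal.exp_add]
  · rfl
  · simp
  · simp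

theorem expNeg_coe (t : ℝ≥0) : expNeg t = ENNReal.ofReal (Real.exp (-(t : ℝ))) := by
  rw [expNeg, ← EReal.exp_coe]; rfl

theorem expNeg_ofReal {t : ℝ} (ht : 0 ≤ t) :
    expNeg (ENNReal.ofReal t) = ENNReal.ofReal (Real.exp (-t)) := by
  rw [ENNReal.ofReal, expNeg_coe, Real.coe_toNNReal t ht]

theorem expNeg_eq_ofReal {t : ℝ≥0∞} (ht : t ≠ ∞) :
    expNeg t = ENNReal.ofReal (Real.exp (-t.toReal)) := by
  lift t to ℝ≥0 using ht
  rw [expNeg_coe, ENNReal.coe_toReal]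

theorem continuous_expNeg : Continuous expNeg :=
  ENNReal.continuous_exp.comp (continuous_neg.comp continuous_coe_ennreal_ereal)

theorem measurable_expNeg : Measurable expNeg := continuous_expNeg.measurable

theorem expNeg_le_one (t : ℝ≥0∞) : expNeg t ≤ 1 := by
  rw [expNeg, EReal.exp_le_one_iff, EReal.neg_le_zero]
  exact EReal.coe_ennreal_nonneg t

theorem expNeg_ne_top (t : ℝ≥0∞) : expNeg t ≠ ∞ :=
  ne_top_of_le_ne_top ENNReal.one_ne_top (expNeg_le_one t)

theorem expNeg_sum {ι : Type*} (s : Finset ι) (t : ι → ℝ≥0∞) :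
    expNeg (∑ i ∈ s, t i) = ∏ i ∈ s, expNeg (t i) := by
  classical
  induction s using Finset.induction_on with
  | empty => simp [expNeg_zero]
  | insert i s hi ih => rw [Finset.sum_insert hi, Finset.prod_insert hi, expNeg_add, ih]

theorem lintegral_fin_prod_eq_prod {n : ℕ} {E : Type*} [MeasurableSpace E]
    (μ : Fin n → Measure E) [∀ i, SigmaFinite (μ i)] (f : Fin n → E → ℝ≥0∞)
    (hf : ∀ i, Measurable (f i)) :
    ∫⁻ x, ∏ i, f i (x i) ∂(Measure.pi μ) = ∏ i, ∫⁻ x, f i x ∂(μ i) := by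
  induction n with
  | zero => simp
  | succ n ih =>
    have hm : AEMeasurable (fun x : Fin n → E => ∏ i, f (Fin.succ i) (x i))
        (Measure.pi fun i => μ (Fin.succ i)) :=
      (Finset.measurable_fun_prod _ fun i _ => (hf _).comp (measurable_pi_apply i)).aemeasurable
    rw [← (measurePreserving_piFinSuccAbove μ 0).symm.lintegral_comp_emb
      (MeasurableEquiv.measurableEmbedding _), Fin.prod_univ_succ,
      ← ih (fun i => μ (Fin.succ i)) (fun i => f (Fin.succ i)) fun i => hf _,
      ← lintegral_prod_mul (hf 0).aemeasurable hm]
    simp [MeasurableEquiv.piFinSuccAbove_symm_apply, Fin.insertNthEquiv, Fin.prod_univ_succ]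

theorem Measure.pi_withDensity_fin {n : ℕ} {E : Type*} [MeasurableSpace E]
    (μ : Fin n → Measure E) [∀ i, SigmaFinite (μ i)] (f : Fin n → E → ℝ≥0∞)
    (hf : ∀ i, Measurable (f i)) [∀ i, SigmaFinite ((μ i).withDensity (f i))] :
    Measure.pi (fun i => (μ i).withDensity (f i))
      = (Measure.pi μ).withDensity fun x => ∏ i, f i (x i) := by
  refine Measure.pi_eq fun s hs => ?_
  rw [withDensity_apply _ (MeasurableSet.univ_pi hs), ← lintegral_indicator (MeasurableSet.univ_pi hs)]
  simp_rw [withDensity_apply _ (hs _), ← lintegral_indicator (hs _)]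
  rw [← lintegral_fin_prod_eq_prod μ _ fun i => (hf i).indicator (hs i)]
  refine lintegral_congr fun x => ?_
  by_cases hx : x ∈ Set.univ.pi s
  · rw [Set.indicator_of_mem hx]
    exact Finset.prod_congr rfl fun i _ => (Set.indicator_of_mem (hx i trivial) _).symm
  · rw [Set.indicator_of_notMem hx]
    simp only [Set.mem_univ_pi, not_forall] at hx
    obtain ⟨i, hi⟩ := hx
    exact (Finset.prod_eq_zero (Finset.mem_univ i) (Set.indicator_of_notMem hi _)).symm

/-! ### The Laplace functional of a Poisson random measure -/

section Poisson

variable {V : Type*} [MeasurableSpace V]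

theorem measurable_expNeg_lintegral {g : V → ℝ≥0∞} (hg : Measurable g) :
    Measurable fun N : Measure V => expNeg (∫⁻ v, g v ∂N) :=
  measurable_expNeg.comp (Measure.measurable_lintegral hg)

theorem lintegral_pointMeasure {k : ℕ} (p : Fin k → V) {g : V → ℝ≥0∞} (hg : Measurable g) :
    ∫⁻ v, g v ∂(pointMeasure p) = ∑ i, g (p i) := by
  rw [pointMeasure, lintegral_finsetSum_measure]
  exact Finset.sum_congr rfl fun i _ => lintegral_dirac' _ hg

theorem laplaceExponent_le_univ (m : Measure V) (g : V → ℝ≥0) :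
    laplaceExponent m g ≤ m Set.univ := by
  rw [← lintegral_one]
  refine lintegral_mono fun v => ?_
  rw [← ENNReal.ofReal_one]
  exact ENNReal.ofReal_le_ofReal (by have := Real.exp_pos (-(g v : ℝ)); linarith)

/-- Stated as a sum because subtraction in `ℝ≥0∞` truncates; it identifies `-m(V) + ∫ e^{-g} dm`
with `-Λ(g)`. -/
theorem laplaceExponent_add_lintegral_expNeg (m : Measure V) {g : V → ℝ≥0} (hg : Measurable g) :
    laplaceExponent m g + ∫⁻ v, expNeg (g v) ∂m = m Set.univ := by
  rw [laplaceExponent, ← lintegral_add_right _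
      (show Measurable fun v => expNeg (g v) from measurable_expNeg.comp hg.coe_nnreal_ennreal),
    ← lintegral_one]
  refine lintegral_congr fun v => ?_
  rw [expNeg_coe, ← ENNReal.ofReal_add _ (Real.exp_nonneg _), sub_add_cancel, ENNReal.ofReal_one]
  simp

/-- On `k`-point configurations `e^{-N(g)}` is a product over the points, with integral `aᵏ`, where
`a = ∫ e^{-g} dm`; the exponential series then sums to `e^{-m(V) + a}`. -/
theorem lintegral_expNeg_poissonLawFinite (m : Measure V) [IsFiniteMeasure m] {g : V → ℝ≥0}
    (hg : Measurable g) :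
    ∫⁻ N, expNeg (∫⁻ v, g v ∂N) ∂(poissonLawFinite m) = expNeg (laplaceExponent m g) := by
  have hg' : Measurable fun v => (g v : ℝ≥0∞) := hg.coe_nnreal_ennreal
  set a := ∫⁻ v, expNeg (g v) ∂m with ha
  have hadd := laplaceExponent_add_lintegral_expNeg m hg
  have hfin : m Set.univ ≠ ∞ := measure_ne_top m _
  have hL : laplaceExponent m g ≠ ∞ := ne_top_of_le_ne_top hfin (laplaceExponent_le_univ m g)
  have ha' : a ≠ ∞ := ne_top_of_le_ne_top hfin (hadd ▸ le_add_self)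
  have hreal : (laplaceExponent m g).toReal + a.toReal = m.real Set.univ := by
    rw [← ENNReal.toReal_add hL ha', hadd]; rfl
  have key : ∀ k : ℕ, ∫⁻ N, expNeg (∫⁻ v, g v ∂N)
      ∂(ENNReal.ofReal (Real.exp (-m.real Set.univ) / (k.factorial : ℝ)) •
        (Measure.pi fun _ : Fin k => m).map pointMeasure)
      = ENNReal.ofReal (Real.exp (-m.real Set.univ) * (a.toReal ^ k / (k.factorial : ℝ))) := by
    intro k
    rw [lintegral_smul_measure, lintegral_map (measurable_expNeg_lintegral hg')
      (measurable_pointMeasure k)]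
    simp_rw [lintegral_pointMeasure _ hg', expNeg_sum]
    rw [lintegral_fin_prod_eq_prod (fun _ => m) (fun _ v => expNeg (g v))
      fun _ => measurable_expNeg.comp hg', Finset.prod_const, Finset.card_univ, Fintype.card_fin,
      ← ha, ← ENNReal.ofReal_toReal ha', ← ENNReal.ofReal_pow (by positivity), smul_eq_mul,
      ← ENNReal.ofReal_mul (by positivity), ENNReal.toReal_ofReal (by positivity)]
    congr 1
    ring
  have hs := (NormedSpace.expSeries_div_hasSum_exp a.toReal).mul_left
      (Real.exp (-m.real Set.univ))
  rw [← Real.exp_eq_exp_ℝ, ← Real.exp_add] at hs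
  rw [poissonLawFinite, lintegral_sum_measure]
  simp_rw [key]
  rw [← ENNReal.ofReal_tsum_of_nonneg (fun k => by positivity) hs.summable, hs.tsum_eq,
    expNeg_eq_ofReal hL]
  congr 2
  linarith

theorem laplaceExponent_sum (m : ℕ → Measure V) (g : V → ℝ≥0) :
    laplaceExponent (Measure.sum m) g = ∑' k, laplaceExponent (m k) g := by
  simp_rw [laplaceExponent, lintegral_sum_measure]

/-- The Laplace functional of a Poisson random measure. -/
theorem lintegral_expNeg_poissonLaw (ν : Measure V) [SFinite ν] {g : V → ℝ≥0}
    (hg : Measurable g) :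
    ∫⁻ N, expNeg (∫⁻ v, g v ∂N) ∂(poissonLaw ν) = expNeg (laplaceExponent ν g) := by
  have hg' : Measurable fun v => (g v : ℝ≥0∞) := hg.coe_nnreal_ennreal
  have hmeas : ∀ k : ℕ, Measurable fun η : ℕ → Measure V => expNeg (∫⁻ v, g v ∂(η k)) := fun k =>
    (measurable_expNeg_lintegral hg').comp (measurable_pi_apply k)
  rw [poissonLaw, lintegral_map (measurable_expNeg_lintegral hg') measurable_measureSum]
  simp_rw [lintegral_sum_measure]
  set Q := Measure.infinitePi fun k : ℕ => poissonLawFinite (sfiniteSeq ν k)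
  have hprod : ∀ K : ℕ, ∫⁻ η, expNeg (∑ k ∈ Finset.range K, ∫⁻ v, g v ∂(η k)) ∂Q
      = expNeg (∑ k ∈ Finset.range K, laplaceExponent (sfiniteSeq ν k) g) := by
    intro K
    simp_rw [expNeg_sum]
    rw [lintegral_prod_eq_prod_lintegral_of_indepFun (μ := Q) (Finset.range K)
      (fun k η => expNeg (∫⁻ v, g v ∂(η k)))
      (iIndepFun_infinitePi (P := fun k : ℕ => poissonLawFinite (sfiniteSeq ν k))
        (X := fun _ N => expNeg (∫⁻ v, g v ∂N)) fun _ => measurable_expNeg_lintegral hg') hmeas]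
    refine Finset.prod_congr rfl fun k _ => ?_
    rw [← lintegral_expNeg_poissonLawFinite _ hg]
    exact (measurePreserving_eval_infinitePi (fun k => poissonLawFinite (sfiniteSeq ν k)) k).lintegral_comp
      (measurable_expNeg_lintegral hg')
  -- Independence handles finitely many summands. Bounded convergence does the rest, as `expNeg ≤
  -- 1`; continuity of `expNeg` at `∞` covers divergent sums.
  have hlim : Tendsto (fun K : ℕ => ∫⁻ η, expNeg (∑ k ∈ Finset.range K, ∫⁻ v, g v ∂(η k)) ∂Q)
      atTop (𝓝 (∫⁻ η, expNeg (∑' k, ∫⁻ v, g v ∂(η k)) ∂Q)) := by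
    refine tendsto_lintegral_of_dominated_convergence (fun _ => 1) (fun K => ?_)
      (fun K => ae_of_all _ fun η => expNeg_le_one _) (by simp) (ae_of_all _ fun η => ?_)
    · simp_rw [expNeg_sum]
      exact Finset.measurable_fun_prod _ fun k _ => hmeas k
    · exact (continuous_expNeg.tendsto _).comp (ENNReal.tendsto_nat_tsum _)
  simp_rw [hprod] at hlim
  refine tendsto_nhds_unique hlim ?_
  -- Only the `ν` in the limit is expanded; those inside `sfiniteSeq ν` must stay.
  conv => enter [3, 1, 1]; rw [← sum_sfiniteSeq ν]
  rw [laplaceExponent_sum]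
  exact (continuous_expNeg.tendsto _).comp (ENNReal.tendsto_nat_tsum _)

end Poisson

/-! ### The cosine representation of the normal density -/

theorem integral_cos_mul_exp_neg_mul_sq {b : ℝ} (hb : 0 < b) (A : ℝ) :
    ∫ y in Set.Ioi (0 : ℝ), Real.cos (y * A) * Real.exp (-(b * y ^ 2))
      = √(Real.pi / b) / 2 * Real.exp (-(A ^ 2 / (4 * b))) := by
  have h1 := fourierIntegral_gaussian (b := (b : ℂ)) (by simpa using hb) (A : ℂ)
  have hint : Integrable fun x : ℝ =>
      Complex.exp (Complex.I * A * x) * Complex.exp (-(b : ℂ) * x ^ 2) := by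
    have := integrable_cexp_quadratic (b := (b : ℂ)) (by simpa using hb) (Complex.I * A) 0
    refine this.congr (ae_of_all _ fun x => ?_)
    simp only
    rw [← Complex.exp_add]
    congr 1
    ring
  have h2 := congrArg Complex.re h1
  rw [← RCLike.re_eq_complex_re, ← integral_re hint] at h2
  -- The even integrand is written in `|x|` so that `integral_comp_abs` folds the line onto the
  -- half-line.
  have hre : ∀ x : ℝ, (Complex.exp (Complex.I * A * x) * Complex.exp (-(b : ℂ) * x ^ 2)).re
      = Real.cos (|x| * A) * Real.exp (-(b * |x| ^ 2)) := by
    intro x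
    have e1 : (-(b : ℂ) * x ^ 2) = ((-(b * x ^ 2) : ℝ) : ℂ) := by push_cast; ring
    have e2 : Complex.I * A * x = ((x * A : ℝ) : ℂ) * Complex.I := by push_cast; ring
    have e3 : Real.cos (|x| * A) = Real.cos (x * A) := by
      rcases abs_cases x with h | h <;> rw [h.1]
      rw [neg_mul, Real.cos_neg]
    rw [e1, e2, ← Complex.ofReal_exp, Complex.re_mul_ofReal, Complex.exp_ofReal_mul_I_re, e3, sq_abs]
  have hrhs : (((Real.pi : ℂ) / b) ^ (1 / 2 : ℂ) * Complex.exp (-(A : ℂ) ^ 2 / (4 * b))).re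
      = √(Real.pi / b) * Real.exp (-(A ^ 2 / (4 * b))) := by
    have e1 : ((Real.pi : ℂ) / b) ^ (1 / 2 : ℂ) = ((√(Real.pi / b) : ℝ) : ℂ) := by
      rw [Real.sqrt_eq_rpow, Complex.ofReal_cpow (by positivity)]
      push_cast
      rfl
    have e2 : (-(A : ℂ) ^ 2 / (4 * b)) = ((-(A ^ 2 / (4 * b)) : ℝ) : ℂ) := by push_cast; ring
    rw [e1, e2, ← Complex.ofReal_exp, ← Complex.ofReal_mul, Complex.ofReal_re]
  have h3 : ∫ x : ℝ, Real.cos (|x| * A) * Real.exp (-(b * |x| ^ 2))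
      = √(Real.pi / b) * Real.exp (-(A ^ 2 / (4 * b))) := by
    exact (integral_congr_ae (ae_of_all _ fun x => (hre x).symm)).trans (h2.trans hrhs)
  rw [integral_comp_abs (f := fun x => Real.cos (x * A) * Real.exp (-(b * x ^ 2)))] at h3
  linarith

/-- The integrand of the cosine representation of the normal density. -/
noncomputable def cosFactor (β A s y : ℝ) : ℝ :=
  Real.cos (y * |A|) * Real.exp (-(s * (y ^ 2 / 2 + β ^ 2 / 2)))

theorem continuous_cosFactor (β A : ℝ) : Continuous fun p : ℝ × ℝ => cosFactor β A p.1 p.2 := by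
  unfold cosFactor
  fun_prop

/-- With `A = x - m`, `-(A - βs)²/(2s) = Aβ - sβ²/2 - A²/(2s)`, and `e^{-A²/(2s)}/√(2πs)` is the
cosine transform of a Gaussian in `y` with exponent `-(s/2)y²`. -/
theorem gaussianPDFReal_eq_integral_cosFactor (m β x : ℝ) {s : ℝ≥0} (hs : s ≠ 0) :
    gaussianPDFReal (m + β * s) s x
      = Real.pi⁻¹ * Real.exp ((x - m) * β) * ∫ y in Set.Ici 0, cosFactor β (x - m) s y := by
  have hs' : (0 : ℝ) < s := by positivity
  have hcos : ∀ y : ℝ, cosFactor β (x - m) s y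
      = Real.exp (-(s * β ^ 2 / 2)) *
        (Real.cos (y * |x - m|) * Real.exp (-((s / 2 : ℝ) * y ^ 2))) := by
    intro y
    rw [cosFactor, mul_left_comm, ← Real.exp_add]
    ring_nf
  simp_rw [integral_Ici_eq_integral_Ioi, hcos]
  rw [integral_const_mul, integral_cos_mul_exp_neg_mul_sq (by positivity), gaussianPDFReal, sq_abs]
  have hroot : (√(2 * Real.pi * s))⁻¹ = Real.pi⁻¹ * (√(Real.pi / (s / 2 : ℝ)) / 2) := by
    have e : Real.pi / (s / 2 : ℝ) = (2 * Real.pi / √(2 * Real.pi * s)) ^ 2 := by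
      rw [div_pow, Real.sq_sqrt (by positivity)]
      field_simp
    rw [e, Real.sqrt_sq (by positivity)]
    field_simp
  have hexp : Real.exp (-(x - (m + β * s)) ^ 2 / (2 * s))
      = Real.exp ((x - m) * β) * Real.exp (-(s * β ^ 2 / 2)) *
        Real.exp (-((x - m) ^ 2 / (4 * (s / 2 : ℝ)))) := by
    rw [← Real.exp_add, ← Real.exp_add]
    congr 1
    field_simp
    ring
  rw [hroot, hexp]
  ring

/-- Integration by parts against `sin(ya)/a`: the exponential factor decreases on `[0, M]` and lies
in `[0, 1]`, so the boundary term and the remainder are each at most `1/a`. What matters is that the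
bound depends on neither `s` nor `M`. -/
theorem abs_setIntegral_cosFactor_le (β : ℝ) {A s M : ℝ} (hA : A ≠ 0) (hs : 0 ≤ s) (hM : 0 ≤ M) :
    |∫ y in Set.Icc 0 M, cosFactor β A s y| ≤ 2 / |A| := by
  have hA' : |A| ≠ 0 := abs_ne_zero.mpr hA
  set a := |A| with ha
  have ha0 : 0 < a := abs_pos.mpr hA
  set u : ℝ → ℝ := fun y => Real.exp (-(s * (y ^ 2 / 2 + β ^ 2 / 2))) with hu
  set u' : ℝ → ℝ := fun y => -(s * y) * u y with hu'
  have hud : ∀ y, HasDerivAt u (u' y) y := by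
    intro y
    have h : HasDerivAt (fun y : ℝ => -(s * (y ^ 2 / 2 + β ^ 2 / 2))) (-(s * y)) y := by
      have := ((((hasDerivAt_pow 2 y).div_const 2).add_const (β ^ 2 / 2)).const_mul s).neg
      exact this.congr_deriv (by norm_num)
    exact h.exp.congr_deriv (mul_comm _ _)
  have hvd : ∀ y, HasDerivAt (fun y => Real.sin (y * a) / a) (Real.cos (y * a)) y := by
    intro y
    have := (((hasDerivAt_id y).mul_const a).sin).div_const a
    exact this.congr_deriv (by simp [hA'])
  have huc : Continuous u := by fun_prop
  have hu'c : Continuous u' := by fun_prop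
  have hu1 : ∀ y, u y ≤ 1 := fun y => by
    rw [hu, Real.exp_le_one_iff]
    have : 0 ≤ s * (y ^ 2 / 2 + β ^ 2 / 2) := by positivity
    linarith
  have hu0 : ∀ y, 0 ≤ u y := fun y => Real.exp_nonneg _
  have hparts := intervalIntegral.integral_mul_deriv_eq_deriv_mul (a := 0) (b := M)
    (fun y _ => hud y) (fun y _ => hvd y) (hu'c.intervalIntegrable _ _)
    ((by fun_prop : Continuous fun y => Real.cos (y * a)).intervalIntegrable _ _)
  have hU : ∫ y in (0 : ℝ)..M, u' y = u M - u 0 :=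
    intervalIntegral.integral_eq_sub_of_hasDerivAt (fun y _ => hud y)
      (hu'c.intervalIntegrable _ _)
  have hsin : ∀ y, |Real.sin (y * a) / a| ≤ 1 / a := fun y => by
    rw [abs_div, abs_of_pos ha0]
    gcongr
    exact Real.abs_sin_le_one _
  -- As `u' ≤ 0` on `[0, M]`, the integral of `|u'|` telescopes to `u 0 - u M ≤ 1`.
  have hrem : |∫ y in (0 : ℝ)..M, u' y * (Real.sin (y * a) / a)| ≤ 1 / a := by
    have h1 : ‖∫ y in (0 : ℝ)..M, u' y * (Real.sin (y * a) / a)‖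
        ≤ ∫ y in (0 : ℝ)..M, -u' y * (1 / a) := by
      refine intervalIntegral.norm_integral_le_of_norm_le hM (ae_of_all _ fun y hy => ?_)
        ((by fun_prop : Continuous fun y => -u' y * (1 / a)).intervalIntegrable _ _)
      have hy0 : u' y ≤ 0 := by
        have : 0 ≤ s * y * u y := mul_nonneg (mul_nonneg hs hy.1.le) (hu0 y)
        simp only [hu']
        linarith
      rw [Real.norm_eq_abs, abs_mul, abs_of_nonpos hy0]
      exact mul_le_mul_of_nonneg_left (hsin y) (by linarith)
    rw [intervalIntegral.integral_mul_const, intervalIntegral.integral_neg, hU] at h1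
    refine h1.trans ?_
    have : -(u M - u 0) ≤ 1 := by linarith [hu1 0, hu0 M]
    calc -(u M - u 0) * (1 / a) ≤ 1 * (1 / a) := by gcongr
      _ = 1 / a := one_mul _
  have heq : ∫ y in Set.Icc 0 M, cosFactor β A s y
      = ∫ y in (0 : ℝ)..M, u y * Real.cos (y * a) := by
    rw [integral_Icc_eq_integral_Ioc, ← intervalIntegral.integral_of_le hM]
    exact intervalIntegral.integral_congr fun y _ => mul_comm _ _
  rw [heq, hparts]
  have hb : |u M * (Real.sin (M * a) / a)| ≤ 1 / a := by
    rw [abs_mul, abs_of_nonneg (hu0 M)]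
    calc u M * |Real.sin (M * a) / a| ≤ 1 * (1 / a) :=
          mul_le_mul (hu1 M) (hsin M) (abs_nonneg _) zero_le_one
      _ = 1 / a := one_mul _
  simp only [zero_mul, Real.sin_zero, zero_div, mul_zero, sub_zero]
  calc _ ≤ |u M * (Real.sin (M * a) / a)| + |∫ y in (0 : ℝ)..M, u' y * (Real.sin (y * a) / a)| :=
        abs_sub _ _
    _ ≤ 1 / a + 1 / a := add_le_add hb hrem
    _ = 2 / a := by ring

theorem integrable_cosFactor (β A : ℝ) {s : ℝ} (hs : 0 < s) : Integrable (cosFactor β A s) := by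
  have h := (integrable_exp_neg_mul_sq (b := s / 2) (by positivity))
  refine h.mono' ((continuous_cosFactor β A).comp (by fun_prop : Continuous fun y : ℝ => (s, y))).aestronglyMeasurable
    (ae_of_all _ fun y => ?_)
  rw [cosFactor, norm_mul, Real.norm_eq_abs, Real.norm_eq_abs, Real.abs_exp]
  calc _ ≤ 1 * Real.exp (-(s * (y ^ 2 / 2 + β ^ 2 / 2))) := by
        gcongr; exact Real.abs_cos_le_one _
    _ ≤ _ := by
      rw [one_mul, Real.exp_le_exp]
      nlinarith [sq_nonneg β, sq_nonneg y]

theorem tendsto_setIntegral_cosFactor (β A : ℝ) {s : ℝ} (hs : 0 < s) :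
    Tendsto (fun M : ℝ => ∫ y in Set.Icc 0 M, cosFactor β A s y) atTop
      (𝓝 (∫ y in Set.Ici 0, cosFactor β A s y)) := by
  rw [integral_Ici_eq_integral_Ioi]
  refine (intervalIntegral_tendsto_integral_Ioi 0 (integrable_cosFactor β A hs).integrableOn
    tendsto_id).congr' ?_
  filter_upwards [eventually_ge_atTop 0] with M hM
  rw [integral_Icc_eq_integral_Ioc, id, intervalIntegral.integral_of_le hM]

/-! ### Laplace exponents, tilting and the density of the returns -/

section Functionals

/-- Extends finiteness assumed on the orthant to all `y`. -/
theorem bigOmega_abs {V : Type*} {n : ℕ} (f : Fin n → V → ℝ≥0) (β : ℝ) (y : Fin n → ℝ) :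
    bigOmega f β (fun i => |y i|) = bigOmega f β y := by
  ext v
  simp [bigOmega]

variable {V : Type*} [MeasurableSpace V] {n : ℕ}

theorem measurable_linearFunctional {f : V → ℝ≥0} (hf : Measurable f) :
    Measurable (linearFunctional f) :=
  (Measure.measurable_lintegral hf.coe_nnreal_ennreal).ennreal_toNNReal

theorem measurable_bigOmega {f : Fin n → V → ℝ≥0} (hf : ∀ i, Measurable (f i)) (β : ℝ)
    (y : Fin n → ℝ) : Measurable (bigOmega f β y) :=
  Finset.measurable_fun_sum _ fun i _ => (hf i).const_mul _

theorem measurable_uncurry_bigOmega {f : Fin n → V → ℝ≥0} (hf : ∀ i, Measurable (f i)) (β : ℝ) :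
    Measurable fun p : (Fin n → ℝ) × V => bigOmega f β p.1 p.2 := by
  refine Finset.measurable_fun_sum _ fun i _ => Measurable.mul ?_ ((hf i).comp measurable_snd)
  fun_prop

theorem measurable_laplaceExponent_bigOmega (ν : Measure V) [SFinite ν] {f : Fin n → V → ℝ≥0}
    (hf : ∀ i, Measurable (f i)) (β : ℝ) {g : V → ℝ≥0} (hg : Measurable g) :
    Measurable fun y : Fin n → ℝ => laplaceExponent ν (g + bigOmega f β y) := by
  unfold laplaceExponent
  refine Measurable.lintegral_prod_right'
    (f := fun p : (Fin n → ℝ) × V => ENNReal.ofReal (1 - Real.exp (-((g + bigOmega f β p.1) p.2 : ℝ≥0)))) ?_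
  have h := (hg.comp measurable_snd).add (measurable_uncurry_bigOmega hf β)
  have h' : Measurable fun p : (Fin n → ℝ) × V => (((g + bigOmega f β p.1) p.2 : ℝ≥0) : ℝ) :=
    h.coe_nnreal_real
  fun_prop

/-- Finiteness of `N(fᵢ)` is essential: `linearFunctional` sends `∞` to `0`. -/
theorem lintegral_add_bigOmega {f : Fin n → V → ℝ≥0} (hf : ∀ i, Measurable (f i)) (β : ℝ)
    {g : V → ℝ≥0} (hg : Measurable g) (y : Fin n → ℝ) {N : Measure V}
    (hN : ∀ i, ∫⁻ v, (f i v : ℝ≥0∞) ∂N < ∞) :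
    ∫⁻ v, ((g + bigOmega f β y) v : ℝ≥0) ∂N
      = ∫⁻ v, g v ∂N
        + ∑ i, ENNReal.ofReal (linearFunctional (f i) N * (y i ^ 2 / 2 + β ^ 2 / 2)) := by
  simp only [Pi.add_apply, ENNReal.coe_add, bigOmega, ENNReal.ofNNReal_finsetSum, ENNReal.coe_mul]
  rw [lintegral_add_left hg.coe_nnreal_ennreal,
    lintegral_finsetSum _ fun i _ => (hf i).coe_nnreal_ennreal.const_mul _]
  congr 1
  refine Finset.sum_congr rfl fun i _ => ?_
  rw [lintegral_const_mul _ (hf i).coe_nnreal_ennreal, mul_comm,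
    ENNReal.ofReal_mul (NNReal.coe_nonneg _), ENNReal.ofReal_coe_nnreal, linearFunctional,
    ENNReal.coe_toNNReal (hN i).ne]
  rfl

theorem toReal_expNeg_lintegral_add_bigOmega {f : Fin n → V → ℝ≥0} (hf : ∀ i, Measurable (f i))
    (β : ℝ) {g : V → ℝ≥0} (hg : Measurable g) (y : Fin n → ℝ) {N : Measure V}
    (hN : ∀ i, ∫⁻ v, (f i v : ℝ≥0∞) ∂N < ∞) :
    (expNeg (∫⁻ v, ((g + bigOmega f β y) v : ℝ≥0) ∂N)).toReal
      = (expNeg (∫⁻ v, g v ∂N)).toReal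
        * ∏ i, Real.exp (-(linearFunctional (f i) N * (y i ^ 2 / 2 + β ^ 2 / 2))) := by
  rw [lintegral_add_bigOmega hf β hg y hN, expNeg_add, expNeg_sum, ENNReal.toReal_mul,
    ENNReal.toReal_prod]
  congr 1
  refine Finset.prod_congr rfl fun i _ => ?_
  rw [expNeg_ofReal (by positivity), ENNReal.toReal_ofReal (Real.exp_nonneg _)]

theorem toReal_expNeg {t : ℝ≥0∞} (ht : t ≠ ∞) : (expNeg t).toReal = Real.exp (-t.toReal) := by
  rw [expNeg_eq_ofReal ht, ENNReal.toReal_ofReal (Real.exp_nonneg _)]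

theorem toReal_expNeg_le_one (t : ℝ≥0∞) : (expNeg t).toReal ≤ 1 :=
  ENNReal.toReal_le_of_le_ofReal zero_le_one (by simpa using expNeg_le_one t)

theorem integral_toReal_expNeg_poissonLaw (ν : Measure V) [SFinite ν] {g : V → ℝ≥0}
    (hg : Measurable g) :
    ∫ N, (expNeg (∫⁻ v, g v ∂N)).toReal ∂(poissonLaw ν) = (expNeg (laplaceExponent ν g)).toReal := by
  rw [integral_toReal (measurable_expNeg_lintegral hg.coe_nnreal_ennreal).aemeasurable
    (ae_of_all _ fun N => (expNeg_ne_top _).lt_top), lintegral_expNeg_poissonLaw ν hg]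

theorem laplaceExponent_mono (ν : Measure V) {g h : V → ℝ≥0} (hgh : g ≤ h) :
    laplaceExponent ν g ≤ laplaceExponent ν h := by
  refine lintegral_mono fun v => ENNReal.ofReal_le_ofReal ?_
  have : (g v : ℝ) ≤ h v := hgh v
  have := Real.exp_le_exp.mpr (neg_le_neg this)
  linarith

/-- Integrate `(1 - e^{-g})e^{-h} + (1 - e^{-h}) = 1 - e^{-(g+h)}`; the additive form avoids `∞ -
∞`. -/
theorem laplaceExponent_tiltedIntensity (ν : Measure V) {g h : V → ℝ≥0} (hg : Measurable g)
    (hh : Measurable h) :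
    laplaceExponent (tiltedIntensity ν h) g + laplaceExponent ν h = laplaceExponent ν (g + h) := by
  have hm : Measurable fun v => ENNReal.ofReal (Real.exp (-(h v : ℝ))) := by fun_prop
  rw [laplaceExponent, lintegral_withDensity_eq_lintegral_mul _ hm (by fun_prop), laplaceExponent,
    ← lintegral_add_right _ (by fun_prop), laplaceExponent]
  refine lintegral_congr fun v => ?_
  have h1 : Real.exp (-(g v : ℝ)) ≤ 1 := by simp
  have h2 : Real.exp (-(h v : ℝ)) ≤ 1 := by simp
  rw [Pi.mul_apply, ← ENNReal.ofReal_mul (Real.exp_nonneg _),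
    ← ENNReal.ofReal_add (mul_nonneg (Real.exp_nonneg _) (by linarith)) (by linarith)]
  congr 1
  rw [Pi.add_apply, NNReal.coe_add, neg_add, Real.exp_add]
  ring

theorem laplaceFunctional_poissonLaw_tiltedIntensity (ν : Measure V) [SFinite ν] {g h : V → ℝ≥0}
    (hg : Measurable g) (hh : Measurable h) (hfin : laplaceExponent ν (g + h) < ∞) :
    laplaceFunctional (poissonLaw (tiltedIntensity ν h)) g
      = Real.exp (-((laplaceExponent ν (g + h)).toReal - (laplaceExponent ν h).toReal)) := by
  have hadd := laplaceExponent_tiltedIntensity ν hg hh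
  have h1 : laplaceExponent (tiltedIntensity ν h) g ≠ ∞ :=
    ne_top_of_le_ne_top hfin.ne (hadd ▸ le_self_add)
  have h2 : laplaceExponent ν h ≠ ∞ := ne_top_of_le_ne_top hfin.ne (hadd ▸ le_add_self)
  have : laplaceFunctional (poissonLaw (tiltedIntensity ν h)) g
      = (expNeg (laplaceExponent (tiltedIntensity ν h) g)).toReal :=
    congrArg ENNReal.toReal (lintegral_expNeg_poissonLaw _ hg)
  rw [this, toReal_expNeg h1, ← hadd, ENNReal.toReal_add h1 h2, add_sub_cancel_right]

theorem measurable_returnDensity {f : Fin n → V → ℝ≥0} (hf : ∀ i, Measurable (f i)) (μ β Δ : ℝ) :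
    Measurable fun p : (Fin n → ℝ) × Measure V => returnDensity f μ β Δ p.1 p.2 := by
  refine Finset.measurable_fun_prod _ fun i _ => ?_
  have h : Measurable fun q : ℝ × ℝ≥0 => gaussianPDF (μ * Δ + β * q.2) q.2 q.1 := by
    unfold gaussianPDF gaussianPDFReal
    fun_prop
  have h' : Measurable fun p : (Fin n → ℝ) × Measure V => (p.1 i, linearFunctional (f i) p.2) :=
    ((measurable_pi_apply i).comp measurable_fst).prodMk
      ((measurable_linearFunctional (hf i)).comp measurable_snd)
  exact Measurable.comp (g := fun q : ℝ × ℝ≥0 => gaussianPDF (μ * Δ + β * q.2) q.2 q.1) h h'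

theorem measurable_returnDensity_right {f : Fin n → V → ℝ≥0} (hf : ∀ i, Measurable (f i))
    (μ β Δ : ℝ) (x : Fin n → ℝ) : Measurable (returnDensity f μ β Δ x) :=
  Measurable.comp (g := fun p : (Fin n → ℝ) × Measure V => returnDensity f μ β Δ p.1 p.2)
    (f := fun N => (x, N)) (measurable_returnDensity hf μ β Δ) measurable_prodMk_left

theorem returnDensity_lt_top (f : Fin n → V → ℝ≥0) (μ β Δ : ℝ) (x : Fin n → ℝ) (N : Measure V) :
    returnDensity f μ β Δ x N < ∞ :=
  ENNReal.prod_lt_top fun _ _ => ENNReal.ofReal_lt_top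

theorem linearFunctional_ne_zero {f : V → ℝ≥0} {N : Measure V}
    (h : 0 < ∫⁻ v, (f v : ℝ≥0∞) ∂N ∧ ∫⁻ v, (f v : ℝ≥0∞) ∂N < ∞) : linearFunctional f N ≠ 0 :=
  (ENNReal.toNNReal_pos h.1.ne' h.2.ne).ne'

theorem returnDensity_pos {f : Fin n → V → ℝ≥0} {N : Measure V}
    (hN : ∀ i, 0 < ∫⁻ v, (f i v : ℝ≥0∞) ∂N ∧ ∫⁻ v, (f i v : ℝ≥0∞) ∂N < ∞)
    (μ β Δ : ℝ) (x : Fin n → ℝ) : 0 < returnDensity f μ β Δ x N := by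
  rw [pos_iff_ne_zero, returnDensity, Finset.prod_ne_zero_iff]
  exact fun i _ => (gaussianPDF_pos _ (linearFunctional_ne_zero (hN i)) _).ne'

/-- The hypothesis on `N` excludes zero variance, where the cosine representation is unavailable. -/
theorem toReal_returnDensity {f : Fin n → V → ℝ≥0} {N : Measure V}
    (hN : ∀ i, 0 < ∫⁻ v, (f i v : ℝ≥0∞) ∂N ∧ ∫⁻ v, (f i v : ℝ≥0∞) ∂N < ∞)
    (μ β Δ : ℝ) (x : Fin n → ℝ) :
    (returnDensity f μ β Δ x N).toReal
      = (Real.pi ^ n)⁻¹ * Real.exp (∑ i, (x i - μ * Δ) * β) *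
        ∏ i, ∫ y in Set.Ici 0, cosFactor β (x i - μ * Δ) (linearFunctional (f i) N) y := by
  rw [returnDensity, ENNReal.toReal_prod]
  simp_rw [toReal_gaussianPDF]
  rw [Finset.prod_congr rfl fun i _ => gaussianPDFReal_eq_integral_cosFactor (μ * Δ) β (x i)
    (linearFunctional_ne_zero (hN i)), Finset.prod_mul_distrib, Finset.prod_mul_distrib,
    ← Real.exp_sum, Finset.prod_const, Finset.card_univ, Fintype.card_fin, inv_pow]

end Functionals

/-! ### Exchanging the integrals over `N` and over `y` -/

/-- Needed for dominated convergence when all `Mᵢ → ∞` independently; the constant vectors `k` are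
cofinal. -/
theorem isCountablyGenerated_atTop_pi (n : ℕ) :
    (atTop : Filter (Fin n → ℝ)).IsCountablyGenerated := by
  have h : (atTop : Filter (Fin n → ℝ)).HasBasis (fun _ : ℕ => True)
      fun k => Set.Ici fun _ => (k : ℝ) := by
    refine atTop_basis.to_hasBasis (fun M _ => ?_) fun k _ => ⟨_, trivial, le_rfl⟩
    obtain ⟨k, hk⟩ := exists_nat_ge (∑ i, |M i|)
    refine ⟨k, trivial, Set.Ici_subset_Ici.mpr fun i => ?_⟩
    exact (le_abs_self _).trans ((Finset.single_le_sum (f := fun i => |M i|)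
      (fun i _ => abs_nonneg _) (Finset.mem_univ i)).trans hk)
  exact h.isCountablyGenerated

section Fubini

variable {V : Type*} [MeasurableSpace V] {n : ℕ}

theorem laplaceExponent_bigOmega_le (ν : Measure V) (f : Fin n → V → ℝ≥0) (β : ℝ) (g : V → ℝ≥0) (y : Fin n → ℝ) :
    laplaceExponent ν (bigOmega f β y) ≤ laplaceExponent ν (g + bigOmega f β y) :=
  laplaceExponent_mono ν (le_add_of_nonneg_left zero_le)

theorem measurable_cosFactor {α : Type*} [MeasurableSpace α] (β A : ℝ) {h k : α → ℝ}
    (hh : Measurable h) (hk : Measurable k) : Measurable fun a => cosFactor β A (h a) (k a) := by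
  unfold cosFactor
  fun_prop

theorem measurable_expNeg_mul_prod_cosFactor {f : Fin n → V → ℝ≥0} (hf : ∀ i, Measurable (f i))
    (β : ℝ) {g : V → ℝ≥0} (hg : Measurable g) (A : Fin n → ℝ) :
    Measurable fun p : Measure V × (Fin n → ℝ) => (expNeg (∫⁻ v, g v ∂p.1)).toReal *
      ∏ i, cosFactor β (A i) (linearFunctional (f i) p.1) (p.2 i) := by
  have h0 : Measurable fun p : Measure V × (Fin n → ℝ) => (expNeg (∫⁻ v, g v ∂p.1)).toReal :=
    Measurable.comp (g := fun N : Measure V => (expNeg (∫⁻ v, g v ∂N)).toReal)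
      (measurable_expNeg_lintegral hg.coe_nnreal_ennreal).ennreal_toReal measurable_fst
  have h1 : ∀ i, Measurable fun p : Measure V × (Fin n → ℝ) =>
      cosFactor β (A i) (linearFunctional (f i) p.1) (p.2 i) := by
    intro i
    have h2 : Measurable fun p : Measure V × (Fin n → ℝ) => (linearFunctional (f i) p.1 : ℝ) :=
      ((measurable_linearFunctional (hf i)).comp measurable_fst).coe_nnreal_real
    have h3 : Measurable fun p : Measure V × (Fin n → ℝ) => p.2 i :=
      (measurable_pi_apply i).comp measurable_snd
    exact measurable_cosFactor β (A i) h2 h3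
  exact h0.mul (Finset.measurable_fun_prod _ fun i _ => h1 i)

/-- Since `|cos| ≤ 1` and `e^{-N(g)} ≤ 1`, the integrand is dominated by `e^{-N(Ωₙ)}`, whose mean
over `N` is `e^{-Λ(Ωₙ)}`. Hence the condition on `S` does not involve `g`. -/
theorem integrable_prod_cosFactor (ν : Measure V) [SFinite ν] {f : Fin n → V → ℝ≥0}
    (hf : ∀ i, Measurable (f i))
    (hτ : ∀ᵐ N ∂poissonLaw ν, ∀ i,
      0 < ∫⁻ v, (f i v : ℝ≥0∞) ∂N ∧ ∫⁻ v, (f i v : ℝ≥0∞) ∂N < ∞)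
    (β : ℝ) {g : V → ℝ≥0} (hg : Measurable g)
    (hfin : ∀ y, laplaceExponent ν (bigOmega f β y) < ∞) (A : Fin n → ℝ)
    {S : Set (Fin n → ℝ)}
    (hint : IntegrableOn (fun y => Real.exp (-(laplaceExponent ν (bigOmega f β y)).toReal)) S) :
    Integrable (fun p : Measure V × (Fin n → ℝ) => (expNeg (∫⁻ v, g v ∂p.1)).toReal *
      ∏ i, cosFactor β (A i) (linearFunctional (f i) p.1) (p.2 i))
      ((poissonLaw ν).prod (volume.restrict S)) := by
  have hmeas := measurable_expNeg_mul_prod_cosFactor hf β hg A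
  have hle : ∀ (N : Measure V) (y : Fin n → ℝ), ‖(expNeg (∫⁻ v, g v ∂N)).toReal *
      ∏ i, cosFactor β (A i) (linearFunctional (f i) N) (y i)‖
      ≤ ∏ i, Real.exp (-(linearFunctional (f i) N * (y i ^ 2 / 2 + β ^ 2 / 2))) := by
    intro N y
    rw [norm_mul, Real.norm_of_nonneg ENNReal.toReal_nonneg, norm_prod]
    calc _ ≤ 1 * ∏ i, ‖cosFactor β (A i) (linearFunctional (f i) N) (y i)‖ := by
          gcongr
          exact toReal_expNeg_le_one _
      _ ≤ _ := by
          rw [one_mul]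
          refine Finset.prod_le_prod (fun i _ => norm_nonneg _) fun i _ => ?_
          rw [cosFactor, norm_mul, Real.norm_of_nonneg (Real.exp_nonneg _)]
          exact mul_le_of_le_one_left (Real.exp_nonneg _) (Real.abs_cos_le_one _)
  have hone : ∀ (N : Measure V) (y : Fin n → ℝ),
      ∏ i, Real.exp (-(linearFunctional (f i) N * (y i ^ 2 / 2 + β ^ 2 / 2))) ≤ 1 := fun N y =>
    Finset.prod_le_one (fun i _ => Real.exp_nonneg _) fun i _ => by
      rw [Real.exp_le_one_iff, neg_nonpos]
      positivity
  have hdom : ∀ y : Fin n → ℝ, Integrable (fun N => ∏ i, Real.exp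
      (-(linearFunctional (f i) N * (y i ^ 2 / 2 + β ^ 2 / 2)))) (poissonLaw ν) := by
    intro y
    refine Integrable.of_bound (C := 1) (Measurable.aestronglyMeasurable ?_)
      (ae_of_all _ fun N => ?_)
    · refine Finset.measurable_fun_prod _ fun i _ => ?_
      have := (measurable_linearFunctional (hf i)).coe_nnreal_real
      fun_prop
    · rw [Real.norm_of_nonneg (Finset.prod_nonneg fun i _ => Real.exp_nonneg _)]
      exact hone N y
  rw [integrable_prod_iff' hmeas.aestronglyMeasurable]
  refine ⟨ae_of_all _ fun y => (hdom y).mono'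
    (hmeas.comp measurable_prodMk_right).aestronglyMeasurable (ae_of_all _ fun N => hle N y), ?_⟩
  refine Integrable.mono' hint
    hmeas.norm.stronglyMeasurable.integral_prod_left'.aestronglyMeasurable
    (ae_of_all _ fun y => ?_)
  rw [Real.norm_of_nonneg (integral_nonneg fun N => norm_nonneg _)]
  have h0 : ∫ N, ∏ i, Real.exp (-(linearFunctional (f i) N * (y i ^ 2 / 2 + β ^ 2 / 2)))
      ∂(poissonLaw ν) = Real.exp (-(laplaceExponent ν (bigOmega f β y)).toReal) := by
    rw [← toReal_expNeg (hfin y).ne, ← integral_toReal_expNeg_poissonLaw ν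
      (measurable_bigOmega hf β y)]
    refine integral_congr_ae (hτ.mono fun N hN => ?_)
    have := toReal_expNeg_lintegral_add_bigOmega hf β (g := 0) measurable_const y fun i => (hN i).2
    simpa [expNeg_zero] using this.symm
  rw [← h0]
  exact integral_mono_of_nonneg (ae_of_all _ fun N => norm_nonneg _) (hdom y)
    (ae_of_all _ fun N => hle N y)

theorem setIntegral_prod_cosFactor (β : ℝ) (A : Fin n → ℝ) (S : Fin n → Set ℝ) (c : ℝ)
    (s : Fin n → ℝ) :
    c * ∏ i, ∫ y in S i, cosFactor β (A i) (s i) y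
      = ∫ y in Set.univ.pi S, c * ∏ i, cosFactor β (A i) (s i) (y i) := by
  rw [integral_const_mul, volume_pi, Measure.restrict_pi_pi, integral_fintype_prod_eq_prod]

/-- Fubini, followed by the Poisson Laplace functional at `g + Ωₙ`. A general product set serves
both the boxes and the orthant. -/
theorem integral_expNeg_mul_prod_setIntegral_cosFactor (ν : Measure V) [SFinite ν] {f : Fin n → V → ℝ≥0}
    (hf : ∀ i, Measurable (f i))
    (hτ : ∀ᵐ N ∂poissonLaw ν, ∀ i,
      0 < ∫⁻ v, (f i v : ℝ≥0∞) ∂N ∧ ∫⁻ v, (f i v : ℝ≥0∞) ∂N < ∞)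
    (β : ℝ) {g : V → ℝ≥0} (hg : Measurable g)
    (hfin : ∀ y, laplaceExponent ν (g + bigOmega f β y) < ∞) (A : Fin n → ℝ)
    {S : Fin n → Set ℝ}
    (hint : IntegrableOn (fun y => Real.exp (-(laplaceExponent ν (bigOmega f β y)).toReal))
      (Set.univ.pi S)) :
    ∫ N, (expNeg (∫⁻ v, g v ∂N)).toReal *
        (∏ i, ∫ y in S i, cosFactor β (A i) (linearFunctional (f i) N) y) ∂(poissonLaw ν)
      = ∫ y in Set.univ.pi S, (∏ i, Real.cos (y i * |A i|)) *
          Real.exp (-(laplaceExponent ν (g + bigOmega f β y)).toReal) := by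
  simp_rw [setIntegral_prod_cosFactor]
  rw [integral_integral_swap (f := fun (N : Measure V) (y : Fin n → ℝ) =>
    (expNeg (∫⁻ v, g v ∂N)).toReal * ∏ i, cosFactor β (A i) (linearFunctional (f i) N) (y i))
    (integrable_prod_cosFactor ν hf hτ β hg
      (fun y => (laplaceExponent_bigOmega_le ν f β g y).trans_lt (hfin y)) A hint)]
  refine integral_congr_ae (ae_of_all _ fun y => ?_)
  simp only
  rw [← toReal_expNeg (hfin y).ne, ← integral_toReal_expNeg_poissonLaw ν
    (hg.add (measurable_bigOmega hf β y)), ← integral_const_mul]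
  refine integral_congr_ae (hτ.mono fun N hN => ?_)
  simp only
  rw [toReal_expNeg_lintegral_add_bigOmega hf β hg y fun i => (hN i).2]
  simp_rw [cosFactor]
  rw [Finset.prod_mul_distrib]
  ring

/-- The constant `∏ 2/|Aᵢ|` dominates, so no integrability over the orthant is required. -/
theorem tendsto_integral_expNeg_mul_prod_setIntegral_cosFactor (ν : Measure V) [SFinite ν] {f : Fin n → V → ℝ≥0}
    (hf : ∀ i, Measurable (f i))
    (hτ : ∀ᵐ N ∂poissonLaw ν, ∀ i,
      0 < ∫⁻ v, (f i v : ℝ≥0∞) ∂N ∧ ∫⁻ v, (f i v : ℝ≥0∞) ∂N < ∞)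
    (β : ℝ) {g : V → ℝ≥0} (hg : Measurable g) {A : Fin n → ℝ} (hA : ∀ i, A i ≠ 0) :
    Tendsto (fun M : Fin n → ℝ => ∫ N, (expNeg (∫⁻ v, g v ∂N)).toReal *
        (∏ i, ∫ y in Set.Icc 0 (M i), cosFactor β (A i) (linearFunctional (f i) N) y) ∂(poissonLaw ν))
      atTop (𝓝 (∫ N, (expNeg (∫⁻ v, g v ∂N)).toReal *
        (∏ i, ∫ y in Set.Ici 0, cosFactor β (A i) (linearFunctional (f i) N) y) ∂(poissonLaw ν))) := by
  have := isCountablyGenerated_atTop_pi n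
  refine tendsto_integral_filter_of_dominated_convergence (fun _ => ∏ i, 2 / |A i|)
    (Eventually.of_forall fun M => Measurable.aestronglyMeasurable ?_) ?_ (integrable_const _) ?_
  · refine Measurable.mul (measurable_expNeg_lintegral hg.coe_nnreal_ennreal).ennreal_toReal ?_
    refine Finset.measurable_fun_prod _ fun i _ => ?_
    have h : StronglyMeasurable fun s : ℝ => ∫ y in Set.Icc 0 (M i), cosFactor β (A i) s y :=
      StronglyMeasurable.integral_prod_right (continuous_cosFactor β (A i)).stronglyMeasurable
    exact h.measurable.comp (measurable_linearFunctional (hf i)).coe_nnreal_real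
  · filter_upwards [eventually_ge_atTop 0] with M hM
    refine ae_of_all _ fun N => ?_
    rw [norm_mul, Real.norm_of_nonneg ENNReal.toReal_nonneg, norm_prod]
    refine (mul_le_of_le_one_left (Finset.prod_nonneg fun i _ => norm_nonneg _)
      (toReal_expNeg_le_one _)).trans (Finset.prod_le_prod (fun i _ => norm_nonneg _) fun i _ => ?_)
    exact abs_setIntegral_cosFactor_le β (hA i) (NNReal.coe_nonneg _) (hM i)
  · filter_upwards [hτ] with N hN
    refine Tendsto.const_mul _ (tendsto_finsetProd _ fun i _ => ?_)
    have hpos : (0 : ℝ) < linearFunctional (f i) N :=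
      NNReal.coe_pos.mpr (pos_iff_ne_zero.mpr (linearFunctional_ne_zero (hN i)))
    refine (tendsto_setIntegral_cosFactor β (A i) hpos).comp ?_
    exact tendsto_atTop_mono' _ (Eventually.of_forall fun _ => le_rfl)
      (tendsto_atTop.mpr fun b => (eventually_ge_atTop fun _ => b).mono fun M hM => hM i)

end Fubini

/-! ### Likelihood and posterior law -/

section Posterior

variable {V : Type*} [MeasurableSpace V] {n : ℕ} {ν : Measure V} [SFinite ν]
  {f : Fin n → V → ℝ≥0}

theorem likelihood_ne_zero (hf : ∀ i, Measurable (f i))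
    (hτ : ∀ᵐ N ∂poissonLaw ν, ∀ i,
      0 < ∫⁻ v, (f i v : ℝ≥0∞) ∂N ∧ ∫⁻ v, (f i v : ℝ≥0∞) ∂N < ∞)
    (μ β Δ : ℝ) (x : Fin n → ℝ) : likelihood ν f μ β Δ x ≠ 0 := by
  rw [likelihood, Ne, lintegral_eq_zero_iff (measurable_returnDensity_right hf μ β Δ x)]
  intro h
  have : ∀ᵐ N ∂poissonLaw ν, False := by
    filter_upwards [h, hτ] with N h1 h2
    exact (returnDensity_pos h2 μ β Δ x).ne' h1
  rw [eventually_false_iff_eq_bot, ae_eq_bot] at this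
  exact IsProbabilityMeasure.ne_zero _ this

/-- Letting `M → ∞` in the bound `2/|A|` controls each normal density uniformly in its variance. At
`A = 0` this breaks down: the density grows like `s^{-1/2}` as `s → 0`. -/
theorem likelihood_lt_top_of_ne
    (hτ : ∀ᵐ N ∂poissonLaw ν, ∀ i,
      0 < ∫⁻ v, (f i v : ℝ≥0∞) ∂N ∧ ∫⁻ v, (f i v : ℝ≥0∞) ∂N < ∞)
    (μ β Δ : ℝ) {x : Fin n → ℝ} (hx : ∀ i, x i ≠ μ * Δ) :
    likelihood ν f μ β Δ x < ∞ := by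
  refine (lintegral_mono_ae (g := fun _ => ENNReal.ofReal ((Real.pi ^ n)⁻¹ *
    Real.exp (∑ i, (x i - μ * Δ) * β) * ∏ i, 2 / |x i - μ * Δ|)) ?_).trans_lt (by simp)
  filter_upwards [hτ] with N hN
  rw [← ENNReal.ofReal_toReal (returnDensity_lt_top f μ β Δ x N).ne]
  refine ENNReal.ofReal_le_ofReal ?_
  rw [toReal_returnDensity hN]
  refine mul_le_mul_of_nonneg_left ?_ (by positivity)
  refine (le_abs_self _).trans ?_
  rw [Finset.abs_prod]
  refine Finset.prod_le_prod (fun i _ => abs_nonneg _) fun i _ => ?_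
  have hpos : (0 : ℝ) < linearFunctional (f i) N :=
    NNReal.coe_pos.mpr (pos_iff_ne_zero.mpr (linearFunctional_ne_zero (hN i)))
  refine le_of_tendsto (tendsto_setIntegral_cosFactor β (x i - μ * Δ) hpos).abs ?_
  filter_upwards [eventually_ge_atTop 0] with M hM
  exact abs_setIntegral_cosFactor_le β (sub_ne_zero.mpr (hx i)) hpos.le hM

/-- With some `Aᵢ = 0` the pointwise bound is lost. Instead, the density is, up to a constant, the
`y`-integral of a function integrable in `(N, y)`, hence integrable in `N`. -/
theorem likelihood_lt_top_of_integrableOn (hf : ∀ i, Measurable (f i))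
    (hτ : ∀ᵐ N ∂poissonLaw ν, ∀ i,
      0 < ∫⁻ v, (f i v : ℝ≥0∞) ∂N ∧ ∫⁻ v, (f i v : ℝ≥0∞) ∂N < ∞)
    (μ β Δ : ℝ)
    (hfin : ∀ y, laplaceExponent ν (bigOmega f β y) < ∞)
    (hint : IntegrableOn (fun y => Real.exp (-(laplaceExponent ν (bigOmega f β y)).toReal))
      (Set.Ici 0)) (x : Fin n → ℝ) :
    likelihood ν f μ β Δ x < ∞ := by
  have h := (integrable_prod_cosFactor ν hf hτ β (g := 0) measurable_const hfin
    (fun i => x i - μ * Δ) hint).integral_prod_left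
  have h2 : Integrable (fun N => (returnDensity f μ β Δ x N).toReal) (poissonLaw ν) := by
    refine (h.const_mul ((Real.pi ^ n)⁻¹ * Real.exp (∑ i, (x i - μ * Δ) * β))).congr ?_
    filter_upwards [hτ] with N hN
    rw [toReal_returnDensity hN, ← one_mul (∏ i, _), setIntegral_prod_cosFactor,
      Set.pi_univ_Ici]
    simp [expNeg_zero]
    rfl
  have h3 := h2.lintegral_lt_top
  refine lt_of_eq_of_lt (lintegral_congr fun N => ?_) h3
  rw [ENNReal.ofReal_toReal (returnDensity_lt_top f μ β Δ x N).ne]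

theorem isProbabilityMeasure_posteriorLaw (hf : ∀ i, Measurable (f i))
    (hτ : ∀ᵐ N ∂poissonLaw ν, ∀ i,
      0 < ∫⁻ v, (f i v : ℝ≥0∞) ∂N ∧ ∫⁻ v, (f i v : ℝ≥0∞) ∂N < ∞)
    (μ β Δ : ℝ) {x : Fin n → ℝ} (hx : likelihood ν f μ β Δ x < ∞) :
    IsProbabilityMeasure (posteriorLaw ν f μ β Δ x) := by
  constructor
  rw [posteriorLaw, Measure.smul_apply, withDensity_apply _ MeasurableSet.univ,
    Measure.restrict_univ, smul_eq_mul]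
  exact ENNReal.inv_mul_cancel (likelihood_ne_zero hf hτ μ β Δ x) hx.ne

theorem laplaceFunctional_posteriorLaw (hf : ∀ i, Measurable (f i))
    (hτ : ∀ᵐ N ∂poissonLaw ν, ∀ i,
      0 < ∫⁻ v, (f i v : ℝ≥0∞) ∂N ∧ ∫⁻ v, (f i v : ℝ≥0∞) ∂N < ∞)
    (μ β Δ : ℝ) (x : Fin n → ℝ) {g : V → ℝ≥0} (hg : Measurable g) :
    laplaceFunctional (posteriorLaw ν f μ β Δ x) g
      = (likelihood ν f μ β Δ x).toReal⁻¹ * ((Real.pi ^ n)⁻¹ * Real.exp (∑ i, (x i - μ * Δ) * β)) *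
        ∫ N, (expNeg (∫⁻ v, g v ∂N)).toReal * (∏ i, ∫ y in Set.Ici 0,
          cosFactor β (x i - μ * Δ) (linearFunctional (f i) N) y) ∂(poissonLaw ν) := by
  have hd := measurable_returnDensity_right hf μ β Δ x
  have he := measurable_expNeg_lintegral hg.coe_nnreal_ennreal
  have h1 : laplaceFunctional (posteriorLaw ν f μ β Δ x) g
      = ((likelihood ν f μ β Δ x)⁻¹ *
        ∫⁻ N, returnDensity f μ β Δ x N * expNeg (∫⁻ v, g v ∂N) ∂(poissonLaw ν)).toReal := by
    have h := lintegral_withDensity_eq_lintegral_mul (poissonLaw ν) hd he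
    simp only [Pi.mul_apply] at h
    rw [← h, ← smul_eq_mul, ← lintegral_smul_measure]
    rfl
  rw [h1, ENNReal.toReal_mul, ENNReal.toReal_inv, mul_assoc, ← integral_const_mul,
    ← integral_toReal (f := fun N => returnDensity f μ β Δ x N * expNeg (∫⁻ v, g v ∂N))
      (hd.mul he).aemeasurable (ae_of_all _ fun N =>
        ENNReal.mul_lt_top (returnDensity_lt_top f μ β Δ x N) (expNeg_ne_top _).lt_top)]
  congr 1
  refine integral_congr_ae (hτ.mono fun N hN => ?_)
  simp only [ENNReal.toReal_mul]
  rw [toReal_returnDensity hN]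
  ring

/-- The factors `e^{±Λ(Ωₙ)}` cancel, leaving the integrand produced by Fubini. -/
theorem exp_mul_mixingDensity (μ β Δ : ℝ) (g : V → ℝ≥0) (x y : Fin n → ℝ) :
    Real.exp (-((laplaceExponent ν (g + bigOmega f β y)).toReal
        - (laplaceExponent ν (bigOmega f β y)).toReal)) * mixingDensity ν f μ β Δ x y
      = (likelihood ν f μ β Δ x).toReal⁻¹ *
          ((Real.pi ^ n)⁻¹ * Real.exp (∑ i, (x i - μ * Δ) * β)) *
        ((∏ i, Real.cos (y i * |x i - μ * Δ|)) *
          Real.exp (-(laplaceExponent ν (g + bigOmega f β y)).toReal)) := by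
  -- For `n = 0` the factor `n⁻¹` is `0`, and both sides vanish.
  have hmean : (n : ℝ) * ((n : ℝ)⁻¹ * ∑ i, (x i - μ * Δ)) * β = ∑ i, (x i - μ * Δ) * β := by
    rw [← Finset.sum_mul]
    rcases Nat.eq_zero_or_pos n with rfl | hn
    · simp
    · rw [mul_inv_cancel_left₀ (by positivity)]
  have hexp : ∀ a b c : ℝ, Real.exp (-(a - b)) * Real.exp (-(b - c)) = Real.exp c * Real.exp (-a) := by
    intro a b c
    rw [← Real.exp_add, ← Real.exp_add]
    ring_nf
  rw [mixingDensity, hmean, div_eq_mul_inv]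
  linear_combination ((likelihood ν f μ β Δ x).toReal⁻¹ * (Real.pi ^ n)⁻¹ *
    ∏ i, Real.cos (y i * |x i - μ * Δ|)) * hexp (laplaceExponent ν (g + bigOmega f β y)).toReal
      (laplaceExponent ν (bigOmega f β y)).toReal (∑ i, (x i - μ * Δ) * β)

theorem integrableOn_mixingDensity (μ β Δ : ℝ)
    (hint : IntegrableOn (fun y => Real.exp (-(laplaceExponent ν (bigOmega f β y)).toReal))
      (Set.Ici 0)) (x : Fin n → ℝ) :
    IntegrableOn (mixingDensity ν f μ β Δ x) (Set.Ici 0) := by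
  have h : mixingDensity ν f μ β Δ x = fun y => (likelihood ν f μ β Δ x).toReal⁻¹ *
      ((Real.pi ^ n)⁻¹ * Real.exp (∑ i, (x i - μ * Δ) * β)) *
        ((∏ i, Real.cos (y i * |x i - μ * Δ|)) *
          Real.exp (-(laplaceExponent ν (bigOmega f β y)).toReal)) := by
    ext y
    simpa using exp_mul_mixingDensity (ν := ν) (f := f) μ β Δ 0 x y
  rw [h]
  refine Integrable.const_mul (Integrable.bdd_mul (c := 1) hint
    (Continuous.aestronglyMeasurable (by fun_prop)) (ae_of_all _ fun y => ?_)) _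
  rw [norm_prod]
  exact Finset.prod_le_one (fun i _ => norm_nonneg _) fun i _ => Real.abs_cos_le_one _

end Posterior

/-! ### The regular conditional distribution -/

section CondDistrib

variable {V : Type*} [MeasurableSpace V] {n : ℕ}

theorem gaussianReal_map_affine (a : ℝ) (s : ℝ≥0) :
    (gaussianReal 0 1).map (fun e => a + √(s : ℝ) * e) = gaussianReal a s := by
  have h : (fun e => a + √(s : ℝ) * e) = (a + ·) ∘ (√(s : ℝ) * ·) := rfl
  rw [h, ← Measure.map_map (by fun_prop) (by fun_prop), gaussianReal_map_const_mul,
    gaussianReal_map_const_add]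
  congr 1
  · simp
  · ext
    simp

/-- A nonzero variance is needed, since `gaussianReal a 0` is a Dirac mass. -/
theorem pi_gaussianReal_map_affine (a : Fin n → ℝ) {s : Fin n → ℝ≥0} (hs : ∀ i, s i ≠ 0) :
    (Measure.pi fun _ : Fin n => gaussianReal 0 1).map (fun e i => a i + √(s i : ℝ) * e i)
      = volume.withDensity fun x => ∏ i, gaussianPDF (a i) (s i) (x i) := by
  have h1 : ∀ i, SigmaFinite ((gaussianReal 0 1).map fun e => a i + √(s i : ℝ) * e) := fun i => by
    rw [gaussianReal_map_affine]
    infer_instance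
  have h2 : ∀ i, SigmaFinite ((volume : Measure ℝ).withDensity (gaussianPDF (a i) (s i))) :=
    fun i => by
      rw [← gaussianReal_of_var_ne_zero _ (hs i)]
      infer_instance
  rw [Measure.pi_map_pi (f := fun i e => a i + √(s i : ℝ) * e)
    fun i => (by fun_prop : Measurable _).aemeasurable]
  simp_rw [gaussianReal_map_affine, fun i => gaussianReal_of_var_ne_zero (a i) (hs i)]
  rw [Measure.pi_withDensity_fin _ _ fun i => measurable_gaussianPDF _ _, volume_pi]

/-- The returns as a function of the random measure and of the noise. -/
noncomputable def returns (f : Fin n → V → ℝ≥0) (μ β Δ : ℝ) (N : Measure V) (e : Fin n → ℝ) :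
    Fin n → ℝ :=
  fun i => μ * Δ + linearFunctional (f i) N * β + √(linearFunctional (f i) N : ℝ) * e i

theorem measurable_returns {f : Fin n → V → ℝ≥0} (hf : ∀ i, Measurable (f i)) (μ β Δ : ℝ) :
    Measurable fun p : Measure V × (Fin n → ℝ) => returns f μ β Δ p.1 p.2 := by
  refine measurable_pi_lambda _ fun i => ?_
  have h2 : Measurable fun p : Measure V × (Fin n → ℝ) => (linearFunctional (f i) p.1 : ℝ) :=
    ((measurable_linearFunctional (hf i)).comp measurable_fst).coe_nnreal_real
  have h3 : Measurable fun p : Measure V × (Fin n → ℝ) => p.2 i :=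
    (measurable_pi_apply i).comp measurable_snd
  exact (measurable_const.add (h2.mul_const β)).add (h2.sqrt.mul h3)

theorem lintegral_returns_eq {f : Fin n → V → ℝ≥0} (μ β Δ : ℝ) {N : Measure V}
    (hN : ∀ i, 0 < ∫⁻ v, (f i v : ℝ≥0∞) ∂N ∧ ∫⁻ v, (f i v : ℝ≥0∞) ∂N < ∞)
    {h : (Fin n → ℝ) → ℝ≥0∞} (hh : Measurable h) :
    ∫⁻ e, h (returns f μ β Δ N e) ∂(Measure.pi fun _ : Fin n => gaussianReal 0 1)
      = ∫⁻ x, returnDensity f μ β Δ x N * h x := by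
  have hmap := pi_gaussianReal_map_affine (fun i => μ * Δ + linearFunctional (f i) N * β)
    fun i => linearFunctional_ne_zero (hN i)
  have hm : Measurable fun x : Fin n → ℝ => ∏ i, gaussianPDF
      (μ * Δ + linearFunctional (f i) N * β) (linearFunctional (f i) N) (x i) :=
    Finset.measurable_fun_prod _ fun i _ =>
      (measurable_gaussianPDF _ _).comp (measurable_pi_apply i)
  have hr : Measurable fun (e : Fin n → ℝ) i => μ * Δ + linearFunctional (f i) N * β
      + √(linearFunctional (f i) N : ℝ) * e i := by fun_prop
  have h1 := lintegral_map (μ := Measure.pi fun _ : Fin n => gaussianReal 0 1) hh hr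
  rw [hmap, lintegral_withDensity_eq_lintegral_mul _ hm hh] at h1
  refine h1.symm.trans (lintegral_congr fun x => ?_)
  rw [Pi.mul_apply, returnDensity]
  simp_rw [mul_comm β]

/-- The joint law of the returns and of the random measure. -/
theorem lintegral_joint_law {ν : Measure V} [SFinite ν] {f : Fin n → V → ℝ≥0}
    (hf : ∀ i, Measurable (f i))
    (hτ : ∀ᵐ N ∂poissonLaw ν, ∀ i,
      0 < ∫⁻ v, (f i v : ℝ≥0∞) ∂N ∧ ∫⁻ v, (f i v : ℝ≥0∞) ∂N < ∞) (μ β Δ : ℝ)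
    {h : (Fin n → ℝ) × Measure V → ℝ≥0∞} (hh : Measurable h) :
    ∫⁻ p, h (returns f μ β Δ p.1 p.2, p.1)
        ∂((poissonLaw ν).prod (Measure.pi fun _ : Fin n => gaussianReal 0 1))
      = ∫⁻ x, ∫⁻ N, returnDensity f μ β Δ x N * h (x, N) ∂(poissonLaw ν) := by
  have hm : Measurable fun p : Measure V × (Fin n → ℝ) => h (returns f μ β Δ p.1 p.2, p.1) :=
    hh.comp ((measurable_returns hf μ β Δ).prodMk measurable_fst)
  have hm' : Measurable fun p : (Fin n → ℝ) × Measure V =>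
      returnDensity f μ β Δ p.1 p.2 * h (p.1, p.2) := (measurable_returnDensity hf μ β Δ).mul hh
  rw [lintegral_prod _ hm.aemeasurable, lintegral_lintegral_swap
    (f := fun (x : Fin n → ℝ) (N : Measure V) => returnDensity f μ β Δ x N * h (x, N))
    hm'.aemeasurable]
  refine lintegral_congr_ae (hτ.mono fun N hN => ?_)
  exact lintegral_returns_eq μ β Δ hN (h := fun x => h (x, N)) (hh.comp measurable_prodMk_right)

theorem measurable_posteriorLaw (ν : Measure V) [SFinite ν] {f : Fin n → V → ℝ≥0}
    (hf : ∀ i, Measurable (f i)) (μ β Δ : ℝ) : Measurable (posteriorLaw ν f μ β Δ) := by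
  have hd := measurable_returnDensity hf μ β Δ
  refine Measure.measurable_of_measurable_coe _ fun s hs => ?_
  have h : ∀ x, posteriorLaw ν f μ β Δ x s = (likelihood ν f μ β Δ x)⁻¹ *
      ∫⁻ N in s, returnDensity f μ β Δ x N ∂(poissonLaw ν) := fun x => by
    rw [posteriorLaw, Measure.smul_apply, withDensity_apply _ hs, smul_eq_mul]
  simp_rw [h]
  exact (Measurable.lintegral_prod_right' (ν := poissonLaw ν) hd).inv.mul
    (Measurable.lintegral_prod_right' (ν := (poissonLaw ν).restrict s) hd)

/-- The posterior laws as a kernel. -/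
noncomputable def posteriorKernel (ν : Measure V) [SFinite ν] {f : Fin n → V → ℝ≥0}
    (hf : ∀ i, Measurable (f i)) (μ β Δ : ℝ) : Kernel (Fin n → ℝ) (Measure V) where
  toFun := posteriorLaw ν f μ β Δ
  measurable' := measurable_posteriorLaw ν hf μ β Δ

/-- Only finite, not Markov: where the likelihood is infinite, its inverse is `0` and the posterior
is the zero measure. -/
theorem isFiniteKernel_posteriorKernel (ν : Measure V) [SFinite ν] {f : Fin n → V → ℝ≥0}
    (hf : ∀ i, Measurable (f i)) (μ β Δ : ℝ) : IsFiniteKernel (posteriorKernel ν hf μ β Δ) := by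
  refine ⟨1, ENNReal.one_lt_top, fun x => ?_⟩
  change posteriorLaw ν f μ β Δ x Set.univ ≤ 1
  rw [posteriorLaw, Measure.smul_apply, withDensity_apply _ MeasurableSet.univ,
    Measure.restrict_univ, smul_eq_mul]
  exact ENNReal.inv_mul_le_one _

theorem likelihood_mul_lintegral_posteriorLaw {ν : Measure V} [SFinite ν] {f : Fin n → V → ℝ≥0}
    (hf : ∀ i, Measurable (f i)) (μ β Δ : ℝ) {x : Fin n → ℝ}
    (h0 : likelihood ν f μ β Δ x ≠ 0) (ht : likelihood ν f μ β Δ x ≠ ∞)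
    {h : Measure V → ℝ≥0∞} (hh : Measurable h) :
    likelihood ν f μ β Δ x * ∫⁻ N, h N ∂(posteriorLaw ν f μ β Δ x)
      = ∫⁻ N, returnDensity f μ β Δ x N * h N ∂(poissonLaw ν) := by
  rw [posteriorLaw, lintegral_smul_measure, smul_eq_mul, ← mul_assoc, ENNReal.mul_inv_cancel h0 ht,
    one_mul, lintegral_withDensity_eq_lintegral_mul _ (measurable_returnDensity_right hf μ β Δ x) hh]
  rfl

/-- Both joint laws are tested against `h`. The law of `X` has the likelihood as Lebesgue density,
which cancels the normalisation of the posterior wherever it is finite, that is, for almost every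
`x`. -/
theorem hasCondDistrib_posteriorKernel {ν : Measure V} [SFinite ν] {f : Fin n → V → ℝ≥0}
    (hf : ∀ i, Measurable (f i))
    (hτ : ∀ᵐ N ∂poissonLaw ν, ∀ i,
      0 < ∫⁻ v, (f i v : ℝ≥0∞) ∂N ∧ ∫⁻ v, (f i v : ℝ≥0∞) ∂N < ∞) (μ β Δ : ℝ)
    {Ω : Type*} [MeasurableSpace Ω] {P : Measure Ω} {N : Ω → Measure V} {ε X : Ω → Fin n → ℝ}
    (hlaw : HasLaw (fun ω => (N ω, ε ω))
      ((poissonLaw ν).prod (Measure.pi fun _ : Fin n => gaussianReal 0 1)) P)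
    (hX : ∀ᵐ ω ∂P, X ω = returns f μ β Δ (N ω) (ε ω)) :
    HasCondDistrib N X (posteriorKernel ν hf μ β Δ) P := by
  have hr := measurable_returns hf μ β Δ
  have hN : AEMeasurable N P := hlaw.aemeasurable.fst
  have hXm : AEMeasurable X P :=
    (hr.comp_aemeasurable hlaw.aemeasurable).congr (hX.mono fun ω h => h.symm)
  have := isFiniteKernel_posteriorKernel ν hf μ β Δ
  have : IsProbabilityMeasure P := hlaw.isProbabilityMeasure
  have key : ∀ h : (Fin n → ℝ) × Measure V → ℝ≥0∞, Measurable h →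
      ∫⁻ ω, h (X ω, N ω) ∂P
        = ∫⁻ x, ∫⁻ N, returnDensity f μ β Δ x N * h (x, N) ∂(poissonLaw ν) := by
    intro h hh
    have hm : Measurable fun p : Measure V × (Fin n → ℝ) => h (returns f μ β Δ p.1 p.2, p.1) :=
      hh.comp (hr.prodMk measurable_fst)
    rw [← lintegral_joint_law hf hτ μ β Δ hh, ← hlaw.lintegral_comp hm.aemeasurable]
    exact lintegral_congr_ae (hX.mono fun ω hω => by simp only [hω])
  refine ⟨hXm.prodMk hN, Measure.ext_of_lintegral _ fun h hh => ?_⟩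
  have hH : Measurable fun x => ∫⁻ N, h (x, N) ∂(posteriorKernel ν hf μ β Δ x) :=
    hh.lintegral_kernel_prod_right'
  rw [lintegral_map' hh.aemeasurable (hXm.prodMk hN), key h hh, Measure.lintegral_compProd hh,
    lintegral_map' hH.aemeasurable hXm,
    -- Here the test function depends on `x` alone, so `key` integrates it against the law of `X`.
    key (fun p => ∫⁻ N, h (p.1, N) ∂(posteriorKernel ν hf μ β Δ p.1)) (hH.comp measurable_fst)]
  have hne : ∀ᵐ x : Fin n → ℝ, ∀ i, x i ≠ μ * Δ :=
    ae_all_iff.mpr fun i => Measure.ae_eval_ne (fun _ => volume) i _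
  refine lintegral_congr_ae (hne.mono fun x hx => ?_)
  simp only
  rw [lintegral_mul_const _ (measurable_returnDensity_right hf μ β Δ x)]
  exact (likelihood_mul_lintegral_posteriorLaw hf μ β Δ (likelihood_ne_zero hf hτ μ β Δ x)
    (likelihood_lt_top_of_ne hτ μ β Δ hx).ne (h := fun N => h (x, N))
    (hh.comp measurable_prodMk_left)).symm

end CondDistrib

/-! ### Assembly -/

theorem proposition2p2 {V : Type*} [TopologicalSpace V] [PolishSpace V] [MeasurableSpace V]
    [BorelSpace V] (ν : Measure V) [SigmaFinite ν]
    {n : ℕ} (f : Fin n → V → ℝ≥0) (hf : ∀ i, Measurable (f i)) (μ β Δ : ℝ)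
    {Ω : Type*} [MeasurableSpace Ω] (P : Measure Ω) [IsProbabilityMeasure P]
    (N : Ω → Measure V) (ε : Fin n → Ω → ℝ) (X : Ω → Fin n → ℝ)
    -- `N` is a Poisson random measure with intensity `ν`, and `0 < τᵢ = N(fᵢ) < ∞` almost surely
    (hN : HasLaw N (poissonLaw ν) P)
    (hτ : ∀ i, ∀ᵐ ω ∂P, 0 < ∫⁻ v, (f i v : ℝ≥0∞) ∂(N ω) ∧ ∫⁻ v, (f i v : ℝ≥0∞) ∂(N ω) < ∞)
    -- the `εᵢ` are independent standard normal variables, independent of `N`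
    (hε : ∀ i, HasLaw (ε i) (gaussianReal 0 1) P) (hεindep : iIndepFun ε P)
    (hNε : IndepFun N (fun ω i => ε i ω) P)
    -- the returns `Xᵢ = μΔ + τᵢβ + τᵢ^{1/2} εᵢ`
    (hX : ∀ᵐ ω ∂P, ∀ i, X ω i = μ * Δ + linearFunctional (f i) (N ω) * β
      + √(linearFunctional (f i) (N ω) : ℝ) * ε i ω) :
    -- `x ↦ posteriorLaw x` is a regular conditional distribution of `N` given `X = x`
    (∃ κ : Kernel (Fin n → ℝ) (Measure V), IsFiniteKernel κ ∧
      (∀ x, κ x = posteriorLaw ν f μ β Δ x) ∧ HasCondDistrib N X κ P) ∧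
    ((∀ x : Fin n → ℝ, (∀ i, x i ≠ μ * Δ) → IsProbabilityMeasure (posteriorLaw ν f μ β Δ x)) ∧
    -- its Laplace functional
    ∀ g : V → ℝ≥0, Measurable g →
      (∀ y : Fin n → ℝ, 0 ≤ y → laplaceExponent ν (g + bigOmega f β y) < ∞) →
      (∀ y : Fin n → ℝ, 0 ≤ y →
        laplaceFunctional (poissonLaw (tiltedIntensity ν (bigOmega f β y))) g
          = Real.exp (-((laplaceExponent ν (g + bigOmega f β y)).toReal
              - (laplaceExponent ν (bigOmega f β y)).toReal))) ∧
      -- in general, with improper integrals over the orthant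
      (∀ x : Fin n → ℝ, (∀ i, x i ≠ μ * Δ) →
        Tendsto (fun M : Fin n → ℝ => ∫ y in Set.Icc 0 M,
            laplaceFunctional (poissonLaw (tiltedIntensity ν (bigOmega f β y))) g
              * mixingDensity ν f μ β Δ x y)
          atTop (𝓝 (laplaceFunctional (posteriorLaw ν f μ β Δ x) g)) ∧
        Tendsto (fun M : Fin n → ℝ => ∫ y in Set.Icc 0 M,
            Real.exp (-((laplaceExponent ν (g + bigOmega f β y)).toReal
              - (laplaceExponent ν (bigOmega f β y)).toReal))
              * mixingDensity ν f μ β Δ x y)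
          atTop (𝓝 (laplaceFunctional (posteriorLaw ν f μ β Δ x) g))) ∧
      -- with Lebesgue integrals, where `𝒬_x` is a finite signed measure
      (IntegrableOn (fun y : Fin n → ℝ =>
          Real.exp (-(laplaceExponent ν (bigOmega f β y)).toReal)) (Set.Ici 0) →
        ∀ x : Fin n → ℝ,
          IsProbabilityMeasure (posteriorLaw ν f μ β Δ x) ∧
          IntegrableOn (mixingDensity ν f μ β Δ x) (Set.Ici 0) ∧
          laplaceFunctional (posteriorLaw ν f μ β Δ x) g
            = ∫ y in Set.Ici 0,
                laplaceFunctional (poissonLaw (tiltedIntensity ν (bigOmega f β y))) g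
                  * mixingDensity ν f μ β Δ x y ∧
          ∫ y in Set.Ici 0,
              laplaceFunctional (poissonLaw (tiltedIntensity ν (bigOmega f β y))) g
                * mixingDensity ν f μ β Δ x y
            = ∫ y in Set.Ici 0,
                Real.exp (-((laplaceExponent ν (g + bigOmega f β y)).toReal
                  - (laplaceExponent ν (bigOmega f β y)).toReal))
                  * mixingDensity ν f μ β Δ x y)) := by
  have hτ' : ∀ᵐ m ∂poissonLaw ν, ∀ i,
      0 < ∫⁻ v, (f i v : ℝ≥0∞) ∂m ∧ ∫⁻ v, (f i v : ℝ≥0∞) ∂m < ∞ := by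
    refine ae_all_iff.mpr fun i => ?_
    have hm : Measurable fun m : Measure V => ∫⁻ v, (f i v : ℝ≥0∞) ∂m :=
      Measure.measurable_lintegral (hf i).coe_nnreal_ennreal
    exact (hN.ae_iff (measurableSet_setOfPred.1 ((measurableSet_lt measurable_const hm).inter
      (measurableSet_lt hm measurable_const)))).1 (hτ i)
  have hXr : ∀ᵐ ω ∂P, X ω = returns f μ β Δ (N ω) (fun i => ε i ω) :=
    hX.mono fun ω h => funext h
  refine ⟨⟨posteriorKernel ν hf μ β Δ, isFiniteKernel_posteriorKernel ν hf μ β Δ, fun _ => rfl,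
    hasCondDistrib_posteriorKernel hf hτ' μ β Δ
      (hNε.hasLaw_prod hN (hεindep.hasLaw_pi hε)) hXr⟩,
    fun x hx => isProbabilityMeasure_posteriorLaw hf hτ' μ β Δ
      (likelihood_lt_top_of_ne hτ' μ β Δ hx), ?_⟩
  intro g hg hfin
  have hfin' : ∀ y, laplaceExponent ν (g + bigOmega f β y) < ∞ := fun y => by
    rw [← bigOmega_abs]
    exact hfin _ fun i => abs_nonneg _
  have hΩfin : ∀ y, laplaceExponent ν (bigOmega f β y) < ∞ := fun y =>
    (laplaceExponent_bigOmega_le ν f β g y).trans_lt (hfin' y)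
  have htilt : ∀ y : Fin n → ℝ,
      laplaceFunctional (poissonLaw (tiltedIntensity ν (bigOmega f β y))) g
        = Real.exp (-((laplaceExponent ν (g + bigOmega f β y)).toReal
            - (laplaceExponent ν (bigOmega f β y)).toReal)) := fun y =>
    laplaceFunctional_poissonLaw_tiltedIntensity ν hg (measurable_bigOmega hf β y) (hfin' y)
  refine ⟨fun y _ => htilt y, ?_, ?_⟩
  · intro x hx
    simp_rw [htilt]
    -- After `htilt` the two limits are the same statement.
    rw [and_self, laplaceFunctional_posteriorLaw hf hτ' μ β Δ x hg]
    simp_rw [exp_mul_mixingDensity]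
    refine ((tendsto_integral_expNeg_mul_prod_setIntegral_cosFactor ν hf hτ' β hg
      fun i => sub_ne_zero.mpr (hx i)).const_mul _).congr fun M => ?_
    rw [integral_const_mul, ← Set.pi_univ_Icc]
    congr 1
    refine integral_expNeg_mul_prod_setIntegral_cosFactor ν hf hτ' β hg hfin' _ ?_
    have hmeas : Measurable fun y : Fin n → ℝ =>
        Real.exp (-(laplaceExponent ν (bigOmega f β y)).toReal) := by
      have h := measurable_laplaceExponent_bigOmega ν hf β (g := 0) measurable_const
      simp only [zero_add] at h
      exact h.ennreal_toReal.neg.exp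
    have hfinvol : volume (Set.univ.pi fun i => Set.Icc 0 (M i)) < ∞ :=
      (isCompact_univ_pi fun i => isCompact_Icc).measure_lt_top
    -- On a box, `e^{-Λ(Ωₙ)} ≤ 1` and finite volume suffice for Fubini.
    refine Measure.integrableOn_of_bounded hfinvol.ne hmeas.aestronglyMeasurable (M := 1)
      (ae_of_all _ fun y => ?_)
    rw [Real.norm_of_nonneg (Real.exp_nonneg _), Real.exp_le_one_iff, neg_nonpos]
    exact ENNReal.toReal_nonneg
  · intro hint x
    refine ⟨isProbabilityMeasure_posteriorLaw hf hτ' μ β Δ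
      (likelihood_lt_top_of_integrableOn hf hτ' μ β Δ hΩfin hint x),
      integrableOn_mixingDensity μ β Δ hint x, ?_, by simp_rw [htilt]⟩
    simp_rw [htilt, exp_mul_mixingDensity]
    rw [laplaceFunctional_posteriorLaw hf hτ' μ β Δ x hg, integral_const_mul]
    congr 1
    have h := integral_expNeg_mul_prod_setIntegral_cosFactor ν hf hτ' β hg hfin'
      (fun i => x i - μ * Δ) (S := fun _ => Set.Ici 0) (by rwa [Set.pi_univ_Ici])
    rwa [Set.pi_univ_Ici] at h
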